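/- Let $T\in(0,\infty)$ and let $k,\ell\in L^1_{\mathrm{loc}}([0,\infty))$ be nonnegative, nonincreasing kernels with $(k*\ell)(t)=\int_0^t k(t-s)\ell(s)\,ds=1$ for all $t\in(0,\infty)$ (written $(k,\ell)\in PC$). Then there exists a constant $c_T\in[0,\infty)$, depending only on $T$ and $(k,\ell)$, with the following property. Let $H$ be a real Hilbert space and, for each $t\in[0,T]$, let $\varphi^t\colon H\to(-\infty,\infty]$ be a proper, lower-semicontinuous, convex functional, with effective domain $D(\varphi^t)=\{w\in H:\varphi^t(w)<\infty\}$, subdifferential $$\partial\varphi^t(z)=\{\xi\in H:\ \varphi^t(v)-\varphi^t(z)\ge(\xi,v-z)_H\ \text{for all } v\in D(\varphi^t)\},$$ and $D(\partial\varphi^t)=\{w\in D(\varphi^t):\partial\varphi^t(w)\ne\emptyset\}$. For $u_0\in H$ and $f,u,\xi\in L^2(0,T;H)$, write $(u,\xi)\in(P)_{u_0,f}$ (so that $u$ is a strong solution on $[0,T]$ of $\partial_t[k*(u-u_0)](t)+\partial\varphi^t(u(t))\ni f(t)$) if $k*(u-u_0)\in W^{1,2}(0,T;H)$, $[k*(u-u_0)](0)=0$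 (for the continuous representative), and, for a.e. $t\in(0,T)$, $$u(t)\in D(\partial\varphi^t),\qquad \xi(t)\in\partial\varphi^t(u(t)),\qquad \partial_t[k*(u-u_0)](t)+\xi(t)=f(t).$$ If $(u_i,\xi_i)\in(P)_{u_{0,i},f_i}$ for $i=1,2$, where $u_{0,i}\in H$ and $f_i\in L^2(0,T;H)$, then $$\|u_1-u_2\|_{L^2(0,T;H)}^2\le c_T\left(\|u_{0,1}-u_{0,2}\|_H^2+\|f_1-f_2\|_{L^2(0,T;H)}^2\right).$$ In particular, if $u_{0,1}=u_{0,2}$ and $f_1=f_2$, then $u_1=u_2$. -/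

import Mathlib

open MeasureTheory Set

open scoped ContDiff

noncomputable section

/-- `φ : H → (-∞, ∞]` is proper, lower semicontinuous and convex. -/
structure IsProperLscConvex {H : Type*} [NormedAddCommGroup H] [InnerProductSpace ℝ H]
    (φ : H → EReal) : Prop where
  ne_bot : ∀ x, φ x ≠ ⊥
  proper : ∃ x, φ x ≠ ⊤
  lsc : LowerSemicontinuous φ
  convex : ∀ (x y : H) (a b : ℝ), 0 < a → 0 < b → a + b = 1 →
    φ (a • x + b • y) ≤ (a : EReal) * φ x + (b : EReal) * φ y

/-- The effective domain `D(φ) = {w | φ w < ∞}`. -/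
def effDomain {H : Type*} (φ : H → EReal) : Set H := {w | φ w < ⊤}

/-- The subdifferential `∂φ(z) = {ξ | φ v - φ z ≥ (ξ, v - z) for all v ∈ D(φ)}`. -/
def subdiff {H : Type*} [NormedAddCommGroup H] [InnerProductSpace ℝ H]
    (φ : H → EReal) (z : H) : Set H :=
  {ξ | ∀ v ∈ effDomain φ, ((inner ℝ ξ (v - z) : ℝ) : EReal) ≤ φ v - φ z}

/-- The domain `D(∂φ) = {w ∈ D(φ) | ∂φ(w) ≠ ∅}`. -/
def subdiffDomain {H : Type*} [NormedAddCommGroup H] [InnerProductSpace ℝ H]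
    (φ : H → EReal) : Set H :=
  {w | w ∈ effDomain φ ∧ (subdiff φ w).Nonempty}

/-- The convolution `(k * w)(t) = ∫₀ᵗ k(t - s) w(s) ds`. -/
def timeConv {E : Type*} [NormedAddCommGroup E] [NormedSpace ℝ E]
    (k : ℝ → ℝ) (w : ℝ → E) (t : ℝ) : E :=
  ∫ s in (0 : ℝ)..t, k (t - s) • w s

/-- A nonnegative, nonincreasing kernel on `(0, ∞)` of class `L¹_loc([0, ∞))`. Values of `k`
outside `(0, ∞)` are irrelevant. -/
structure IsMonotoneKernel (k : ℝ → ℝ) : Prop where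
  locallyIntegrable : LocallyIntegrableOn k (Ici 0)
  nonneg : ∀ t, 0 < t → 0 ≤ k t
  antitone : AntitoneOn k (Ioi 0)

/-- `(k, ℓ) ∈ PC`. -/
structure IsPCPair (k l : ℝ → ℝ) : Prop where
  left : IsMonotoneKernel k
  right : IsMonotoneKernel l
  conv_eq_one : ∀ t, 0 < t → timeConv k l t = 1

/-- The Bochner space `L²(0, T; H)`. -/
abbrev L2Space (T : ℝ) (H : Type*) [NormedAddCommGroup H] : Type _ :=
  Lp H 2 (volume.restrict (Ioo 0 T))

/-- `g ∈ L²(0, T; H)` is the weak derivative of `v` on `(0, T)`. -/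
def HasWeakDeriv {H : Type*} [NormedAddCommGroup H] [NormedSpace ℝ H]
    (T : ℝ) (v : ℝ → H) (g : L2Space T H) : Prop :=
  ∀ ψ : ℝ → ℝ, ContDiff ℝ ∞ ψ → HasCompactSupport ψ → tsupport ψ ⊆ Ioo 0 T →
    ∫ t in Ioo 0 T, deriv ψ t • v t = -∫ t in Ioo 0 T, ψ t • g t

/-- `v ∈ W^{1,2}(0, T; H)`. -/
def MemW12 {H : Type*} [NormedAddCommGroup H] [NormedSpace ℝ H]
    (T : ℝ) (v : ℝ → H) : Prop :=
  MemLp v 2 (volume.restrict (Ioo 0 T)) ∧ ∃ g : L2Space T H, HasWeakDeriv T v g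

/-- `v(0) = a` in the sense of the continuous representative of `v` on `[0, T]`. -/
def HasInitialValue {H : Type*} [NormedAddCommGroup H]
    (T : ℝ) (v : ℝ → H) (a : H) : Prop :=
  ∃ w : ℝ → H, ContinuousOn w (Icc 0 T) ∧ v =ᵐ[volume.restrict (Ioo 0 T)] w ∧ w 0 = a

/-- `u` is a strong solution on `[0, T]`, with the selection `ξ` of `∂φᵗ(u(t))`, of
`∂ₜ[k * (u - u₀)](t) + ∂φᵗ(u(t)) ∋ f(t)`, for the data `(u₀, f)`. -/
structure IsStrongSolutionPair {H : Type*} [NormedAddCommGroup H] [InnerProductSpace ℝ H]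
    (T : ℝ) (k : ℝ → ℝ) (φ : ℝ → H → EReal) (u₀ : H) (f u ξ : L2Space T H) : Prop where
  memW12 : MemW12 T (timeConv k (fun s => u s - u₀))
  initial : HasInitialValue T (timeConv k (fun s => u s - u₀)) 0
  mem_domain : ∀ᵐ t ∂(volume.restrict (Ioo 0 T)), u t ∈ subdiffDomain (φ t)
  selection : ∀ᵐ t ∂(volume.restrict (Ioo 0 T)), ξ t ∈ subdiff (φ t) (u t)
  equation : ∃ g : L2Space T H, HasWeakDeriv T (timeConv k (fun s => u s - u₀)) g ∧
    ∀ᵐ t ∂(volume.restrict (Ioo 0 T)), g t + ξ t = f t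

end

/-! Write `1` for the Heaviside function. Truncating the kernels to `(0, T)` changes no convolution
on `(0, T)`. If `g = f - ξ` is the weak derivative of `k * (u - u₀)`, the initial value zero gives
`k * (u - u₀) = 1 * g`; convolving with `ℓ` and using `ℓ * k = 1` yields `u = u₀ + ℓ * g`
(`IsStrongSolutionPair.exists_eq_convL2`).

For two solutions, let `a`, `h`, `g` be the differences of the initial values, the right-hand sides
and the weak derivatives, and let `w = ℓ * g`. Monotonicity of the subdifferential gives `(h - g, a
+ w) ≥ 0` in `L²(0, T; H)`. The estimate then rests on `½ (k * ‖w‖²)(T) ≤ ∫₀ᵀ (g, w)`. Its left side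
is at least `½ k(T) ‖w‖²`, and it also controls `∫₀ᵀ (g, a) = ((k * w)(T), a)`, so no norm of `g` is
needed (`convL2_coercive`). Absorbing terms bounds `w`; here `k(T) > 0` is essential
(`IsPCPair.left_pos`).

The key inequality is the integrated form of `(∂ₜ(k * w), w) ≥ ½ ∂ₜ(k * ‖w‖²)`. It is proved by
backward difference quotients, without regularizing `k`. For bounded `g`, the increments of `w` over
a time `s` are at most a multiple of `L(s) = ∫₀ˢ ℓ`. Since `k L ≤ 1`, the possibly singular
contribution of `k` near zero to a step of size `δ` is `O(δ L(δ)) = o(δ)`. Density extends the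
result to all of `L²`. -/

section

open Filter Topology ContinuousLinearMap
open scoped Convolution ENNReal

/-! ### Causal kernels and truncation -/

/-- An integrable, nonnegative kernel on the line that vanishes on `(-∞, 0]` and is nonincreasing
on `(0, ∞)`. -/
structure IsCausalKernel (a : ℝ → ℝ) : Prop where
  integrable : Integrable a
  eq_zero : ∀ t ≤ 0, a t = 0
  nonneg : ∀ t, 0 ≤ a t
  antitone : AntitoneOn a (Ioi 0)

theorem IsMonotoneKernel.integrableOn {k : ℝ → ℝ} (hk : IsMonotoneKernel k) (T : ℝ) :
    IntegrableOn k (Ioo 0 T) :=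
  (hk.locallyIntegrable.integrableOn_compact_subset Icc_subset_Ici_self
    (isCompact_Icc (a := 0) (b := T))).mono_set Ioo_subset_Icc_self

theorem IsMonotoneKernel.isCausalKernel {k : ℝ → ℝ} (hk : IsMonotoneKernel k) (T : ℝ) :
    IsCausalKernel ((Ioo 0 T).indicator k) where
  integrable := (hk.integrableOn T).integrable_indicator measurableSet_Ioo
  eq_zero t ht := indicator_of_notMem (fun h => absurd h.1 (not_lt.2 ht)) _
  nonneg t := indicator_nonneg (fun s hs => hk.nonneg s hs.1) t
  antitone := by
    intro x hx y hy hxy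
    by_cases hyT : y < T
    · rw [indicator_of_mem (show y ∈ Ioo 0 T from ⟨hy, hyT⟩),
        indicator_of_mem (show x ∈ Ioo 0 T from ⟨hx, hxy.trans_lt hyT⟩)]
      exact hk.antitone hx hy hxy
    · rw [indicator_of_notMem (show y ∉ Ioo 0 T from fun h => hyT h.2)]
      exact indicator_nonneg (fun s hs => hk.nonneg s hs.1) x

/-- On `(0, T)` the convolution of truncations is the causal convolution. -/
theorem convolution_indicator_eq_timeConv {E : Type*} [NormedAddCommGroup E] [NormedSpace ℝ E]
    (k : ℝ → ℝ) (w : ℝ → E) {T t : ℝ} (ht : t ∈ Ioo 0 T) :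
    ((Ioo 0 T).indicator k ⋆[lsmul ℝ ℝ] (Ioo 0 T).indicator w) t = timeConv k w t := by
  rw [convolution_lsmul_swap, timeConv, intervalIntegral.integral_of_le ht.1.le,
    integral_Ioc_eq_integral_Ioo, ← integral_indicator measurableSet_Ioo]
  congr 1
  ext s
  obtain ⟨h0, hT⟩ := ht
  by_cases hs : s ∈ Ioo 0 t
  · rw [indicator_of_mem hs, indicator_of_mem (show s ∈ Ioo 0 T from ⟨hs.1, hs.2.trans hT⟩),
      indicator_of_mem (show t - s ∈ Ioo 0 T from ⟨by linarith [hs.2], by linarith [hs.1]⟩)]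
  · rw [indicator_of_notMem hs]
    by_cases h : 0 < s
    · rw [indicator_of_notMem (show t - s ∉ Ioo 0 T from
        fun h' => hs ⟨h, by linarith [h'.1]⟩), zero_smul]
    · rw [indicator_of_notMem (show s ∉ Ioo 0 T from fun h' => h h'.1), smul_zero]

namespace IsCausalKernel

variable {a : ℝ → ℝ} (ha : IsCausalKernel a)
include ha

theorem setIntegral_nonneg (s : ℝ) : 0 ≤ ∫ x in Ioc 0 s, a x :=
  integral_nonneg fun x => ha.nonneg x

theorem setIntegral_mono {s t : ℝ} (h : s ≤ t) : ∫ x in Ioc 0 s, a x ≤ ∫ x in Ioc 0 t, a x :=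
  setIntegral_mono_set ha.integrable.integrableOn (Eventually.of_forall ha.nonneg)
    (Ioc_subset_Ioc_right h).eventuallyLE

theorem tendsto_setIntegral_zero : Tendsto (fun s => ∫ x in Ioc 0 s, a x) (𝓝[>] 0) (𝓝 0) := by
  have h := (intervalIntegral.continuous_primitive (fun x y => ha.integrable.intervalIntegrable)
    0).tendsto (0 : ℝ)
  rw [intervalIntegral.integral_same] at h
  refine (h.mono_left nhdsWithin_le_nhds).congr' ?_
  filter_upwards [self_mem_nhdsWithin] with s hs
  rw [intervalIntegral.integral_of_le (le_of_lt hs)]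

theorem sub_shift_nonpos {s x : ℝ} (hs : 0 < s) (hx : x ∉ Ioc 0 s) : a x - a (x - s) ≤ 0 := by
  by_cases h : 0 < x
  · have hsx : s < x := not_le.1 fun h' => hx ⟨h, h'⟩
    exact sub_nonpos.2 (ha.antitone (mem_Ioi.2 (by linarith)) h (by linarith))
  · rw [ha.eq_zero x (not_lt.1 h), zero_sub]
    exact neg_nonpos.2 (ha.nonneg _)

theorem sub_shift_eq {s x : ℝ} (hx : x ∈ Ioc 0 s) : a x - a (x - s) = a x := by
  rw [ha.eq_zero (x - s) (by linarith [hx.2]), sub_zero]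

/-- The difference has zero integral and is nonpositive off `(0, s]`, where it equals `a`; so `|y| =
2 y⁺ - y` integrates to twice the integral of `a` over `(0, s]`. This is the source of every modulus
of continuity below. -/
theorem integral_abs_sub_shift_le {s : ℝ} (hs : 0 < s) :
    ∫ x, |a x - a (x - s)| ≤ 2 * ∫ x in Ioc 0 s, a x := by
  have hi : Integrable (fun x => a x - a (x - s)) :=
    ha.integrable.sub (ha.integrable.comp_sub_right s)
  have h0 : ∫ x, (a x - a (x - s)) = 0 := by
    rw [integral_sub ha.integrable (ha.integrable.comp_sub_right s),
      integral_sub_right_eq_self a s, sub_self]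
  have hind : Integrable ((Ioc 0 s).indicator a) :=
    ha.integrable.indicator measurableSet_Ioc
  have key : ∀ x, |a x - a (x - s)| = 2 * (Ioc 0 s).indicator a x - (a x - a (x - s)) := by
    intro x
    by_cases hx : x ∈ Ioc 0 s
    · rw [indicator_of_mem hx, ha.sub_shift_eq hx, abs_of_nonneg (ha.nonneg x)]
      ring
    · rw [indicator_of_notMem hx, abs_of_nonpos (ha.sub_shift_nonpos hs hx)]
      ring
  simp_rw [key]
  rw [integral_sub (hind.const_mul 2) hi, h0, integral_const_mul,
    integral_indicator measurableSet_Ioc, sub_zero]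

end IsCausalKernel

/-- If `k * l = 1` at `t`, then `k(t) ∫₀ᵗ l ≤ 1`. -/
theorem IsCausalKernel.mul_setIntegral_le_one {k l : ℝ → ℝ} (hk : IsCausalKernel k)
    (hl : IsCausalKernel l) {t : ℝ} (h : (k ⋆[lsmul ℝ ℝ] l) t = 1) :
    k t * ∫ x in Ioc 0 t, l x ≤ 1 := by
  rw [convolution_lsmul_swap] at h
  have hi := integrable_of_integral_eq_one h
  rw [← h, ← integral_const_mul, ← integral_indicator measurableSet_Ioc]
  refine integral_mono_ae ((hl.integrable.const_mul _).indicator measurableSet_Ioc) hi ?_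
  -- At `x = t` the kernel takes its default value `k 0 = 0`, and monotonicity does not apply.
  have : ∀ᵐ x : ℝ, x ≠ t := by simp [ae_iff]
  filter_upwards [this] with x hxt
  by_cases hx : x ∈ Ioc 0 t
  · rw [indicator_of_mem hx]
    refine mul_le_mul_of_nonneg_right (hk.antitone (mem_Ioi.2 ?_) (mem_Ioi.2 (hx.1.trans_le hx.2))
      (by linarith [hx.1])) (hl.nonneg x)
    have := lt_of_le_of_ne hx.2 hxt
    linarith
  · rw [indicator_of_notMem hx]
    exact mul_nonneg (hk.nonneg _) (hl.nonneg _)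

/-! ### Positivity of the first kernel -/

theorem IsMonotoneKernel.intervalIntegrable {k : ℝ → ℝ} (hk : IsMonotoneKernel k) {t : ℝ}
    (ht : 0 ≤ t) : IntervalIntegrable k volume 0 t := by
  rw [intervalIntegrable_iff_integrableOn_Ioo_of_le ht]
  exact hk.integrableOn t

/-- The integral of a nonintegrable function is `0` by default, so the value `1` forces
integrability. -/
theorem IsPCPair.intervalIntegrable {k l : ℝ → ℝ} (h : IsPCPair k l) {t : ℝ} (ht : 0 < t) :
    IntervalIntegrable (fun s => k (t - s) * l s) volume 0 t :=
  Classical.not_not.1 fun h' => by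
    have h1 := h.conv_eq_one t ht
    rw [timeConv] at h1
    simp only [smul_eq_mul] at h1
    rw [intervalIntegral.integral_undef h'] at h1
    exact zero_ne_one h1

theorem IsPCPair.integral_eq_one {k l : ℝ → ℝ} (h : IsPCPair k l) {t : ℝ} (ht : 0 < t) :
    ∫ s in (0 : ℝ)..t, k (t - s) * l s = 1 := by
  simpa [timeConv] using h.conv_eq_one t ht

/-- The first kernel of a pair `(k, ℓ) ∈ PC` never vanishes. -/
theorem IsPCPair.left_pos {k l : ℝ → ℝ} (h : IsPCPair k l) {T : ℝ} (hT : 0 < T) : 0 < k T := by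
  -- Let `a` be the infimum of the zeros of `k` and `K = ∫₀ᵃ k`. Comparing `ℓ` with `ℓ(a)` in `k * ℓ
  -- = 1` at `2a` and at `a` gives `ℓ(a) K = 1` and `ℓ = ℓ(a)` a.e. on `(0, a)`. At `a / 2` the
  -- identity then leaves no mass of `k` on `(a / 2, a)`, where `k > 0`.
  by_contra hkT
  set Z : Set ℝ := {t | 0 < t ∧ k t = 0} with hZ
  have hTZ : T ∈ Z := ⟨hT, le_antisymm (not_lt.1 hkT) (h.left.nonneg T hT)⟩
  obtain ⟨t₀, ht₀, hkt₀⟩ : ∃ t, 0 < t ∧ 0 < k t := by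
    by_contra! hne
    have h1 := h.integral_eq_one hT
    rw [intervalIntegral.integral_of_le hT.le, integral_Ioc_eq_integral_Ioo,
      setIntegral_congr_fun (g := fun _ => (0 : ℝ)) measurableSet_Ioo] at h1
    · simp at h1
    · intro s hs
      have hs' : 0 < T - s := by linarith [hs.2]
      simp [le_antisymm (hne _ hs') (h.left.nonneg _ hs')]
  have hlow : ∀ t ∈ Z, t₀ ≤ t := by
    intro t ht
    by_contra! hlt
    have := h.left.antitone (mem_Ioi.2 ht.1) (mem_Ioi.2 ht₀) hlt.le
    rw [ht.2] at this
    exact absurd hkt₀ (not_lt.2 this)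
  have hbdd : BddBelow Z := ⟨t₀, hlow⟩
  set a := sInf Z with ha
  have ha0 : 0 < a := ht₀.trans_le (le_csInf ⟨T, hTZ⟩ hlow)
  have hzero : ∀ t, a < t → k t = 0 := by
    intro t ht
    obtain ⟨s, hs, hst⟩ := exists_lt_of_csInf_lt ⟨T, hTZ⟩ ht
    refine le_antisymm ?_ (h.left.nonneg t (ha0.trans ht))
    rw [← hs.2]
    exact h.left.antitone (mem_Ioi.2 hs.1) (mem_Ioi.2 (ha0.trans ht)) hst.le
  have hpos : ∀ t, 0 < t → t < a → 0 < k t := fun t h0 hta =>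
    lt_of_le_of_ne (h.left.nonneg t h0) fun h' => not_lt.2 (csInf_le hbdd ⟨h0, h'.symm⟩) hta
  set K := ∫ s in (0 : ℝ)..a, k s with hK
  have hshift : ∀ t : ℝ, ∫ s in (0 : ℝ)..t, k (t - s) = ∫ s in (0 : ℝ)..t, k s := by
    intro t
    simp [intervalIntegral.integral_comp_sub_left]
  have hki : ∀ t : ℝ, 0 ≤ t → IntervalIntegrable (fun s => k (t - s)) volume 0 t := by
    intro t ht
    simpa using ((h.left.intervalIntegrable ht).comp_sub_left t).symm
  -- At time `2a` only `s ∈ (a, 2a)` contributes, and there `ℓ(s) ≤ ℓ(a)`.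
  have hup : 1 ≤ l a * K := by
    have h2a : 0 < 2 * a := by linarith
    have hi := h.intervalIntegrable h2a
    have hi1 : IntervalIntegrable (fun s => k (2 * a - s) * l s) volume 0 a :=
      hi.mono_set (by
        rw [uIcc_of_le ha0.le, uIcc_of_le h2a.le]
        exact Icc_subset_Icc_right (by linarith))
    have hi2 : IntervalIntegrable (fun s => k (2 * a - s) * l s) volume a (2 * a) :=
      hi.mono_set (by
        rw [uIcc_of_le (by linarith : a ≤ 2 * a), uIcc_of_le h2a.le]
        exact Icc_subset_Icc_left ha0.le)
    rw [← h.integral_eq_one h2a, ← intervalIntegral.integral_add_adjacent_intervals hi1 hi2]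
    have e1 : ∫ s in (0 : ℝ)..a, k (2 * a - s) * l s = 0 := by
      rw [intervalIntegral.integral_of_le ha0.le, integral_Ioc_eq_integral_Ioo,
        setIntegral_congr_fun (g := fun _ => (0 : ℝ)) measurableSet_Ioo]
      · simp
      · intro s hs
        simp [hzero (2 * a - s) (by linarith [hs.2])]
    have hki2 : IntervalIntegrable (fun s => k (2 * a - s)) volume a (2 * a) := by
      have := ((h.left.intervalIntegrable ha0.le).comp_sub_left (2 * a)).symm
      rw [sub_zero, show 2 * a - a = a by ring] at this
      exact this
    have e2 : ∫ s in a..(2 * a), k (2 * a - s) * l s ≤ ∫ s in a..(2 * a), k (2 * a - s) * l a := by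
      refine intervalIntegral.integral_mono_on_of_le_Ioo (by linarith) hi2 (hki2.mul_const _) ?_
      intro s hs
      exact mul_le_mul_of_nonneg_left
        (h.right.antitone (mem_Ioi.2 ha0) (mem_Ioi.2 (ha0.trans hs.1)) hs.1.le)
        (h.left.nonneg _ (by linarith [hs.2]))
    have e3 : ∫ s in a..(2 * a), k (2 * a - s) * l a = l a * K := by
      rw [intervalIntegral.integral_mul_const, intervalIntegral.integral_comp_sub_left, mul_comm]
      norm_num [hK, show 2 * a - a = a by ring]
    linarith
  have hia := h.intervalIntegrable ha0
  have hint : IntervalIntegrable (fun s => k (a - s) * (l s - l a)) volume 0 a := by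
    have := hia.sub ((hki a ha0.le).mul_const (l a))
    simpa [mul_sub] using this
  have hnn : ∀ s ∈ Ioo 0 a, 0 ≤ k (a - s) * (l s - l a) := fun s hs =>
    mul_nonneg (h.left.nonneg _ (by linarith [hs.2]))
      (sub_nonneg.2 (h.right.antitone (mem_Ioi.2 hs.1) (mem_Ioi.2 ha0) hs.2.le))
  have hval : ∫ s in (0 : ℝ)..a, k (a - s) * (l s - l a) = 1 - l a * K := by
    simp only [mul_sub]
    rw [intervalIntegral.integral_sub hia ((hki a ha0.le).mul_const (l a)), h.integral_eq_one ha0,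
      intervalIntegral.integral_mul_const, hshift, mul_comm]
  rw [intervalIntegral.integral_of_le ha0.le, integral_Ioc_eq_integral_Ioo] at hval
  have hnn' : 0 ≤ᵐ[volume.restrict (Ioo 0 a)] fun s => k (a - s) * (l s - l a) :=
    (ae_restrict_iff' measurableSet_Ioo).2 (Eventually.of_forall hnn)
  have hge : 0 ≤ 1 - l a * K := by
    rw [← hval]
    exact integral_nonneg_of_ae hnn'
  have hlK : l a * K = 1 := by linarith
  rw [hlK, sub_self] at hval
  have hae := (integral_eq_zero_iff_of_nonneg_ae hnn'
    ((intervalIntegrable_iff_integrableOn_Ioo_of_le ha0.le).1 hint)).1 hval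
  have hae' : ∀ᵐ s, s ∈ Ioo 0 a → l s = l a := by
    filter_upwards [(ae_restrict_iff' measurableSet_Ioo).1 hae] with s hs hsa
    have := (mul_eq_zero.1 (hs hsa)).resolve_left
      (hpos _ (by linarith [hsa.2]) (by linarith [hsa.1])).ne'
    linarith
  have hhalf : ∫ s in (0 : ℝ)..(a / 2), k s = K := by
    have h1 := h.integral_eq_one (half_pos ha0)
    rw [intervalIntegral.integral_congr_ae (g := fun s => k (a / 2 - s) * l a),
      intervalIntegral.integral_mul_const, hshift] at h1
    · have hla : l a ≠ 0 := fun h0 => by simp [h0] at hlK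
      refine mul_left_cancel₀ hla ?_
      rw [hlK, mul_comm, h1]
    · filter_upwards [hae'] with s hs hsm
      rw [uIoc_of_le (half_pos ha0).le] at hsm
      rw [hs ⟨hsm.1, by linarith [hsm.2]⟩]
  have hk2 : IntervalIntegrable k volume (a / 2) a :=
    (h.left.intervalIntegrable ha0.le).mono_set (by
      rw [uIcc_of_le (by linarith : a / 2 ≤ a), uIcc_of_le ha0.le]
      exact Icc_subset_Icc_left (half_pos ha0).le)
  have hadd := intervalIntegral.integral_add_adjacent_intervals
    (h.left.intervalIntegrable (half_pos ha0).le) hk2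
  have hlast : 0 < ∫ s in (a / 2)..a, k s :=
    intervalIntegral.intervalIntegral_pos_of_pos_on hk2
      (fun s hs => hpos s (by linarith [hs.1]) hs.2) (by linarith)
  rw [hhalf, ← hK] at hadd
  linarith

/-! ### Young's inequality and convolution operators on `L²(0, T; H)` -/

/-- Cauchy–Schwarz after splitting `a b` as `a^{1/2} · (a^{1/2} b)`. -/
theorem ENNReal.sq_lintegral_mul_le {α : Type*} [MeasurableSpace α] {μ : Measure α}
    {a b : α → ℝ≥0∞} (ha : AEMeasurable a μ) (hb : AEMeasurable b μ) :
    (∫⁻ x, a x * b x ∂μ) ^ 2 ≤ (∫⁻ x, a x ∂μ) * ∫⁻ x, a x * b x ^ 2 ∂μ := by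
  have h := ENNReal.lintegral_mul_le_Lp_mul_Lq μ Real.HolderConjugate.two_two
    (f := fun x => a x ^ (1 / 2 : ℝ)) (g := fun x => a x ^ (1 / 2 : ℝ) * b x)
    (ha.pow_const _) ((ha.pow_const _).mul hb)
  have e1 : ∀ x, a x ^ (1 / 2 : ℝ) * a x ^ (1 / 2 : ℝ) = a x := fun x => by
    rw [← ENNReal.rpow_add_of_nonneg _ _ (by norm_num) (by norm_num)]
    norm_num
  have e2 : ∀ x, (a x ^ (1 / 2 : ℝ)) ^ (2 : ℝ) = a x := fun x => by
    rw [← ENNReal.rpow_mul]; norm_num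
  have e3 : ∀ x, (a x ^ (1 / 2 : ℝ) * b x) ^ (2 : ℝ) = a x * b x ^ 2 := fun x => by
    rw [ENNReal.mul_rpow_of_nonneg _ _ (by norm_num), e2, ENNReal.rpow_two]
  simp only [Pi.mul_apply, ← mul_assoc, e1, e2, e3] at h
  calc (∫⁻ x, a x * b x ∂μ) ^ 2
      ≤ ((∫⁻ x, a x ∂μ) ^ (1 / 2 : ℝ) * (∫⁻ x, a x * b x ^ 2 ∂μ) ^ (1 / 2 : ℝ)) ^ 2 := by gcongr
    _ = _ := by
      rw [mul_pow, ← ENNReal.rpow_two, ← ENNReal.rpow_two, ← ENNReal.rpow_mul, ← ENNReal.rpow_mul]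
      norm_num

section Young

variable {H : Type*} [NormedAddCommGroup H] [NormedSpace ℝ H]

/-- Young's inequality `‖a * f‖₂ ≤ ‖a‖₁ ‖f‖₂`, squared. -/
theorem lintegral_enorm_convolution_sq_le {a : ℝ → ℝ} {f : ℝ → H} (ha : Integrable a)
    (hf : AEStronglyMeasurable f) :
    ∫⁻ t, ‖(a ⋆[lsmul ℝ ℝ] f) t‖ₑ ^ 2 ≤ (∫⁻ s, ‖a s‖ₑ) ^ 2 * ∫⁻ t, ‖f t‖ₑ ^ 2 := by
  have ham : AEMeasurable (fun s => ‖a s‖ₑ) := ha.aestronglyMeasurable.enorm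
  have hfm : AEMeasurable (fun s => ‖f s‖ₑ) := hf.enorm
  have hshift : ∀ t : ℝ, AEMeasurable (fun s => ‖f (t - s)‖ₑ) := fun t =>
    hfm.comp_quasiMeasurePreserving (quasiMeasurePreserving_sub_left_of_right_invariant volume t)
  have h1 : ∀ t, ‖(a ⋆[lsmul ℝ ℝ] f) t‖ₑ ^ 2 ≤
      (∫⁻ s, ‖a s‖ₑ) * ∫⁻ s, ‖a s‖ₑ * ‖f (t - s)‖ₑ ^ 2 := by
    intro t
    refine le_trans ?_ (ENNReal.sq_lintegral_mul_le ham (hshift t))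
    gcongr
    rw [convolution_lsmul]
    refine (enorm_integral_le_lintegral_enorm _).trans (le_of_eq ?_)
    simp [enorm_smul]
  calc ∫⁻ t, ‖(a ⋆[lsmul ℝ ℝ] f) t‖ₑ ^ 2
      ≤ ∫⁻ t, (∫⁻ s, ‖a s‖ₑ) * ∫⁻ s, ‖a s‖ₑ * ‖f (t - s)‖ₑ ^ 2 := lintegral_mono h1
    _ = (∫⁻ s, ‖a s‖ₑ) * ∫⁻ t, ∫⁻ s, ‖a s‖ₑ * ‖f (t - s)‖ₑ ^ 2 :=
      lintegral_const_mul' _ _ ha.2.ne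
    _ = (∫⁻ s, ‖a s‖ₑ) * ∫⁻ s, ∫⁻ t, ‖a s‖ₑ * ‖f (t - s)‖ₑ ^ 2 := by
      rw [lintegral_lintegral_swap]
      refine (ham.comp_snd).mul (AEMeasurable.pow_const ?_ 2)
      exact hfm.comp_quasiMeasurePreserving (quasiMeasurePreserving_sub volume volume)
    _ = (∫⁻ s, ‖a s‖ₑ) * ∫⁻ s, ‖a s‖ₑ * ∫⁻ t, ‖f t‖ₑ ^ 2 := by
      congr 2
      ext s
      rw [lintegral_const_mul' _ _ enorm_ne_top,
        lintegral_sub_right_eq_self (fun t => ‖f t‖ₑ ^ 2) s]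
    _ = _ := by
      rw [lintegral_mul_const'' _ ham, sq, mul_assoc]

theorem eLpNorm_two_sq {α E : Type*} [MeasurableSpace α] [NormedAddCommGroup E] {μ : Measure α}
    (f : α → E) : eLpNorm f 2 μ ^ 2 = ∫⁻ x, ‖f x‖ₑ ^ 2 ∂μ := by
  have := eLpNorm_nnreal_pow_eq_lintegral (f := f) (μ := μ) (p := 2) two_ne_zero
  simpa using this

theorem eLpNorm_convolution_le {a : ℝ → ℝ} {f : ℝ → H} (ha : Integrable a)
    (hf : AEStronglyMeasurable f) :
    eLpNorm (a ⋆[lsmul ℝ ℝ] f) 2 ≤ ENNReal.ofReal (∫ s, ‖a s‖) * eLpNorm f 2 := by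
  rw [← ENNReal.pow_le_pow_left_iff two_ne_zero, mul_pow, eLpNorm_two_sq, eLpNorm_two_sq,
    ofReal_integral_norm_eq_lintegral_enorm ha]
  exact lintegral_enorm_convolution_sq_le ha hf

section Operator

variable {T : ℝ}

omit [NormedSpace ℝ H] in
theorem indicator_Lp_integrable (f : L2Space T H) : Integrable ((Ioo 0 T).indicator f) :=
  (integrable_indicator_iff measurableSet_Ioo).2 ((Lp.memLp f).integrable (by norm_num))

theorem eLpNorm_convolution_indicator_le {a : ℝ → ℝ} (ha : Integrable a) (f : L2Space T H) :
    eLpNorm (a ⋆[lsmul ℝ ℝ] (Ioo 0 T).indicator f) 2 (volume.restrict (Ioo 0 T)) ≤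
      ENNReal.ofReal (∫ s, ‖a s‖) * eLpNorm f 2 (volume.restrict (Ioo 0 T)) := by
  have h := eLpNorm_convolution_le ha (indicator_Lp_integrable f).aestronglyMeasurable
  rw [eLpNorm_indicator_eq_eLpNorm_restrict (f := f) measurableSet_Ioo] at h
  exact (eLpNorm_mono_measure _ Measure.restrict_le_self).trans h

theorem memLp_convolution_indicator {a : ℝ → ℝ} (ha : Integrable a) (f : L2Space T H) :
    MemLp (a ⋆[lsmul ℝ ℝ] (Ioo 0 T).indicator f) 2 (volume.restrict (Ioo 0 T)) :=
  ⟨(ha.integrable_convolution (lsmul ℝ ℝ)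
      (indicator_Lp_integrable f)).aestronglyMeasurable.restrict,
    (eLpNorm_convolution_indicator_le ha f).trans_lt
      (ENNReal.mul_lt_top ENNReal.ofReal_lt_top (Lp.eLpNorm_lt_top f))⟩

omit [NormedSpace ℝ H] in
theorem indicator_ae_eq {f g : ℝ → H} (h : f =ᵐ[volume.restrict (Ioo 0 T)] g) :
    (Ioo 0 T).indicator f =ᵐ[volume] (Ioo 0 T).indicator g :=
  (ae_eq_restrict_iff_indicator_ae_eq measurableSet_Ioo).1 h

/-- Convolution with an integrable kernel as an operator on `L²(0, T; H)`. -/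
noncomputable def convL2 (T : ℝ) (H : Type*) [NormedAddCommGroup H] [NormedSpace ℝ H] (a : ℝ → ℝ)
    (ha : Integrable a) : L2Space T H →L[ℝ] L2Space T H :=
  LinearMap.mkContinuous
    { toFun := fun f => (memLp_convolution_indicator ha f).toLp _
      map_add' := fun f g => by
        rw [← MemLp.toLp_add]
        refine MemLp.toLp_congr _ _ (ae_restrict_of_ae ?_)
        have e : (Ioo 0 T).indicator (f + g : L2Space T H) =ᵐ[volume]
            (Ioo 0 T).indicator f + (Ioo 0 T).indicator g := by
          rw [← indicator_add']
          exact indicator_ae_eq (Lp.coeFn_add f g)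
        filter_upwards [ha.ae_convolution_exists (lsmul ℝ ℝ) (indicator_Lp_integrable f),
          ha.ae_convolution_exists (lsmul ℝ ℝ) (indicator_Lp_integrable g)] with t hf hg
        rw [convolution_congr (lsmul ℝ ℝ) (ae_eq_refl a) e, hf.distrib_add hg]
        rfl
      map_smul' := fun c f => by
        rw [RingHom.id_apply, ← MemLp.toLp_const_smul]
        refine MemLp.toLp_congr _ _ (Eventually.of_forall fun t => ?_)
        have e : (Ioo 0 T).indicator (c • f : L2Space T H) =ᵐ[volume]
            c • (Ioo 0 T).indicator f := by
          change _ =ᵐ[volume] fun x => c • (Ioo 0 T).indicator f x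
          rw [← indicator_const_smul]
          exact indicator_ae_eq (Lp.coeFn_smul c f)
        rw [convolution_congr (lsmul ℝ ℝ) (ae_eq_refl a) e, convolution_smul] }
    (∫ s, ‖a s‖) fun f => by
      change ‖(memLp_convolution_indicator ha f).toLp _‖ ≤ _
      rw [Lp.norm_toLp, Lp.norm_def]
      refine ENNReal.toReal_le_of_le_ofReal
        (mul_nonneg (integral_nonneg fun s => norm_nonneg _) ENNReal.toReal_nonneg) ?_
      rw [ENNReal.ofReal_mul (integral_nonneg fun s => norm_nonneg _),
        ENNReal.ofReal_toReal (Lp.eLpNorm_ne_top f)]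
      exact eLpNorm_convolution_indicator_le ha f

theorem convL2_ae_eq {a : ℝ → ℝ} (ha : Integrable a) (f : L2Space T H) :
    convL2 T H a ha f =ᵐ[volume.restrict (Ioo 0 T)] (a ⋆[lsmul ℝ ℝ] (Ioo 0 T).indicator f) :=
  MemLp.coeFn_toLp (memLp_convolution_indicator ha f)

end Operator

end Young

/-! ### Calculus of causal convolutions -/

section Causal

variable {E : Type*} [NormedAddCommGroup E] [NormedSpace ℝ E]

theorem convolution_assoc_ae [CompleteSpace E] {a b : ℝ → ℝ} {f : ℝ → E} (ha : Integrable a)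
    (hb : Integrable b) (hf : Integrable f) :
    ((a ⋆[lsmul ℝ ℝ] b) ⋆[lsmul ℝ ℝ] f) =ᵐ[volume] (a ⋆[lsmul ℝ ℝ] (b ⋆[lsmul ℝ ℝ] f)) := by
  filter_upwards [ha.norm.ae_convolution_exists (mul ℝ ℝ)
    (hb.norm.integrable_convolution (mul ℝ ℝ) hf.norm)] with t ht
  exact convolution_assoc (lsmul ℝ ℝ) (lsmul ℝ ℝ) (lsmul ℝ ℝ) (lsmul ℝ ℝ)
    (fun x y z => mul_smul x y z) ha.aestronglyMeasurable hb.aestronglyMeasurable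
    hf.aestronglyMeasurable (ha.ae_convolution_exists _ hb)
    (hb.norm.ae_convolution_exists _ hf.norm) ht

theorem convolution_comm (a b : ℝ → ℝ) : (a ⋆[lsmul ℝ ℝ] b) = (b ⋆[lsmul ℝ ℝ] a) := by
  ext t
  rw [convolution_lsmul, convolution_lsmul_swap]
  simp [mul_comm]

/-- Causality: values of `f` after `T` do not enter up to time `T`. This matters because the
identities for truncated kernels hold only before `T`. -/
theorem convolution_congr_right_of_causal {a : ℝ → ℝ} (ha : ∀ t ≤ 0, a t = 0) {f f' : ℝ → E}
    {T t : ℝ} (h : ∀ᵐ s, s < T → f s = f' s) (ht : t ≤ T) :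
    (a ⋆[lsmul ℝ ℝ] f) t = (a ⋆[lsmul ℝ ℝ] f') t := by
  rw [convolution_lsmul_swap, convolution_lsmul_swap]
  refine integral_congr_ae ?_
  filter_upwards [h] with s hs
  by_cases hst : s < t
  · rw [hs (hst.trans_le ht)]
  · rw [ha (t - s) (by linarith), zero_smul, zero_smul]

theorem convolution_congr_left_of_causal {a b : ℝ → ℝ} {f : ℝ → E} (hf : ∀ t ≤ 0, f t = 0)
    {T t : ℝ} (h : ∀ᵐ s, s < T → a s = b s) (ht : t ≤ T) :
    (a ⋆[lsmul ℝ ℝ] f) t = (b ⋆[lsmul ℝ ℝ] f) t := by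
  rw [convolution_lsmul, convolution_lsmul]
  refine integral_congr_ae ?_
  filter_upwards [h] with s hs
  by_cases hst : s < t
  · rw [hs (hst.trans_le ht)]
  · rw [hf (t - s) (by linarith), smul_zero, smul_zero]

theorem convolution_eq_zero_of_nonpos {a : ℝ → ℝ} {f : ℝ → E} (ha : ∀ t ≤ 0, a t = 0)
    (hf : ∀ t ≤ 0, f t = 0) {t : ℝ} (ht : t ≤ 0) : (a ⋆[lsmul ℝ ℝ] f) t = 0 := by
  rw [convolution_lsmul]
  refine integral_eq_zero_of_ae (Eventually.of_forall fun s => ?_)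
  by_cases hs : s ≤ 0
  · simp [ha s hs]
  · simp [hf (t - s) (by linarith)]

/-- Convolution with the truncated Heaviside function is the primitive. -/
theorem convolution_one_eq_integral {T t : ℝ} {f : ℝ → E} (hf : ∀ t ≤ 0, f t = 0) (ht : t ≤ T) :
    ((Ioo 0 T).indicator (fun _ => (1 : ℝ)) ⋆[lsmul ℝ ℝ] f) t = ∫ s in (0 : ℝ)..t, f s := by
  rcases le_or_gt t 0 with h0 | h0
  · rw [convolution_eq_zero_of_nonpos _ hf h0, intervalIntegral.integral_symm,
      intervalIntegral.integral_of_le h0, setIntegral_congr_fun (g := fun _ => (0 : E))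
        measurableSet_Ioc fun s hs => hf s hs.2]
    · simp
    · exact fun t ht => indicator_of_notMem (fun h => absurd h.1 (not_lt.2 ht)) _
  · rw [convolution_lsmul_swap, intervalIntegral.integral_of_le h0.le,
      integral_Ioc_eq_integral_Ioo, ← integral_indicator measurableSet_Ioo]
    congr 1
    ext s
    by_cases hs0 : s ≤ 0
    · rw [hf s hs0, smul_zero, indicator_of_notMem fun h => absurd h.1 (not_lt.2 hs0)]
    · by_cases hst : s < t
      · rw [indicator_of_mem (show s ∈ Ioo 0 t from ⟨not_le.1 hs0, hst⟩),
          indicator_of_mem (show t - s ∈ Ioo 0 T from ⟨by linarith, by linarith⟩), one_smul]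
      · rw [indicator_of_notMem (fun h : t - s ∈ Ioo 0 T => hst (by linarith [h.1])), zero_smul,
          indicator_of_notMem fun h => hst h.2]

/-- If `k * l = 1` on `(0, T)`, then `k * (l * f)` is the primitive of `f`. -/
theorem convolution_convolution_ae_eq_integral [CompleteSpace E] {T : ℝ} {k l : ℝ → ℝ}
    (hk : Integrable k) (hk0 : ∀ t ≤ 0, k t = 0) (hl : Integrable l) (hl0 : ∀ t ≤ 0, l t = 0)
    (hkl : ∀ t ∈ Ioo 0 T, (k ⋆[lsmul ℝ ℝ] l) t = 1) {f : ℝ → E} (hf : Integrable f)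
    (hf0 : ∀ t ≤ 0, f t = 0) :
    ∀ᵐ t, t < T → (k ⋆[lsmul ℝ ℝ] (l ⋆[lsmul ℝ ℝ] f)) t = ∫ s in (0 : ℝ)..t, f s := by
  filter_upwards [convolution_assoc_ae hk hl hf] with t ht htT
  rw [← ht, ← convolution_one_eq_integral hf0 htT.le]
  refine convolution_congr_left_of_causal hf0 (Eventually.of_forall fun s hs => ?_) htT.le
  rcases le_or_gt s 0 with h0 | h0
  · rw [convolution_eq_zero_of_nonpos hk0 hl0 h0,
      indicator_of_notMem fun h => absurd h.1 (not_lt.2 h0)]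
  · rw [hkl s ⟨h0, hs⟩, indicator_of_mem (show s ∈ Ioo 0 T from ⟨h0, hs⟩)]

/-- The shift is moved onto the kernel, so `f` need only be bounded. Applied to `ℓ`, this bounds the
increments of `w` by a multiple of `L(s) = ∫₀ˢ ℓ`. -/
theorem norm_convolution_sub_shift_le {a : ℝ → ℝ} (ha : IsCausalKernel a) {f : ℝ → E}
    (hf : AEStronglyMeasurable f) {M : ℝ} (hM : ∀ x, ‖f x‖ ≤ M) (t : ℝ) {s : ℝ} (hs : 0 < s) :
    ‖(a ⋆[lsmul ℝ ℝ] f) t - (a ⋆[lsmul ℝ ℝ] f) (t - s)‖ ≤ 2 * M * ∫ x in Ioc 0 s, a x := by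
  have hM0 : 0 ≤ M := (norm_nonneg _).trans (hM 0)
  have hint : ∀ c : ℝ, Integrable fun x => a (c - x) • f x := fun c =>
    (ha.integrable.comp_sub_left c).smul_bdd M hf (Eventually.of_forall hM)
  have hi : Integrable fun x => |a x - a (x - s)| :=
    (ha.integrable.sub (ha.integrable.comp_sub_right s)).abs
  rw [convolution_lsmul_swap, convolution_lsmul_swap, ← integral_sub (hint t) (hint (t - s))]
  calc _ ≤ ∫ x, |a (t - x) - a (t - x - s)| * M := by
        refine norm_integral_le_of_norm_le ((hi.comp_sub_left t).mul_const M)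
          (Eventually.of_forall fun x => ?_)
        rw [← sub_smul, norm_smul, Real.norm_eq_abs, show t - s - x = t - x - s by ring]
        exact mul_le_mul_of_nonneg_left (hM x) (abs_nonneg _)
    _ = (∫ x, |a x - a (x - s)|) * M := by
        rw [integral_mul_const, integral_sub_left_eq_self (fun x => |a x - a (x - s)|) volume t]
    _ ≤ (2 * ∫ x in Ioc 0 s, a x) * M :=
        mul_le_mul_of_nonneg_right (ha.integral_abs_sub_shift_le hs) hM0
    _ = _ := by ring

theorem norm_convolution_le {a : ℝ → ℝ} (ha : Integrable a) {f : ℝ → E} {M : ℝ}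
    (hM : ∀ x, ‖f x‖ ≤ M) (t : ℝ) : ‖(a ⋆[lsmul ℝ ℝ] f) t‖ ≤ (∫ x, ‖a x‖) * M := by
  rw [convolution_lsmul, ← integral_mul_const]
  refine norm_integral_le_of_norm_le (ha.norm.mul_const M) (Eventually.of_forall fun x => ?_)
  rw [norm_smul]
  exact mul_le_mul_of_nonneg_left (hM _) (norm_nonneg _)

theorem continuous_convolution_of_bounded {a : ℝ → ℝ} (ha : IsCausalKernel a) {f : ℝ → E}
    (hf : AEStronglyMeasurable f) {M : ℝ} (hM : ∀ x, ‖f x‖ ≤ M) :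
    Continuous (a ⋆[lsmul ℝ ℝ] f) := by
  have hlim : Tendsto (fun s => 2 * M * ∫ x in Ioc 0 s, a x) (𝓝[>] 0) (𝓝 0) := by
    simpa using ha.tendsto_setIntegral_zero.const_mul (2 * M)
  rw [Metric.continuous_iff']
  intro t ε hε
  obtain ⟨δ, hδ, h⟩ := mem_nhdsGT_iff_exists_Ioo_subset.1 (hlim.eventually (gt_mem_nhds hε))
  have hδ : 0 < δ := hδ
  filter_upwards [Metric.ball_mem_nhds t hδ] with x hx
  rw [Metric.mem_ball, Real.dist_eq] at hx
  rcases lt_trichotomy x t with hxt | rfl | hxt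
  · have hs : 0 < t - x := by linarith
    have h1 := norm_convolution_sub_shift_le ha hf hM t hs
    rw [sub_sub_cancel] at h1
    rw [dist_comm, dist_eq_norm]
    exact h1.trans_lt (h ⟨hs, by rwa [abs_of_neg (by linarith), neg_sub] at hx⟩)
  · simpa using hε
  · have hs : 0 < x - t := by linarith
    have h1 := norm_convolution_sub_shift_le ha hf hM x hs
    rw [sub_sub_cancel] at h1
    rw [dist_eq_norm]
    exact h1.trans_lt (h ⟨hs, by rwa [abs_of_pos hs] at hx⟩)

end Causal

/-! ### The energy inequality for `k * w` -/

section CoreInequality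

variable {H : Type*} [NormedAddCommGroup H] [InnerProductSpace ℝ H]

theorem inner_eq_half_norm_sq (x y : H) :
    inner ℝ x y = (1 / 2) * (‖x‖ ^ 2 + ‖y‖ ^ 2 - ‖y - x‖ ^ 2) := by
  rw [norm_sub_sq_real, real_inner_comm x y]
  ring

theorem integrable_smul_of_bounded {a : ℝ → ℝ} (ha : Integrable a) {E : Type*}
    [NormedAddCommGroup E] [NormedSpace ℝ E] {w : ℝ → E} (hw : Continuous w) {B : ℝ}
    (hB : ∀ x, ‖w x‖ ≤ B) : Integrable fun s => a s • w s :=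
  ha.smul_bdd B hw.aestronglyMeasurable (Eventually.of_forall hB)

/-- Polarization under the integral. It is applied to both `k` and its shift: the terms in `∫ a`
cancel in the difference, leaving increments of `k * ‖w‖²` and one error term. -/
theorem inner_integral_smul_shift [CompleteSpace H] {a : ℝ → ℝ} (ha : Integrable a) {w : ℝ → H}
    (hw : Continuous w) {B : ℝ} (hB : ∀ x, ‖w x‖ ≤ B) (t : ℝ) :
    inner ℝ (∫ s, a s • w (t - s)) (w t) =
      (1 / 2) * ((∫ s, a s • ‖w (t - s)‖ ^ 2) + (∫ s, a s) * ‖w t‖ ^ 2 -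
        ∫ s, a s • ‖w t - w (t - s)‖ ^ 2) := by
  have i1 : Integrable fun s => a s • w (t - s) :=
    integrable_smul_of_bounded ha (hw.comp (continuous_const.sub continuous_id))
      fun x => hB (t - x)
  have i2 : Integrable fun s => a s • ‖w (t - s)‖ ^ 2 :=
    integrable_smul_of_bounded (B := B ^ 2) ha (by fun_prop) fun x => by
      rw [Real.norm_eq_abs, abs_of_nonneg (sq_nonneg _)]
      gcongr
      exact hB _
  have i3 : Integrable fun s => a s • ‖w t - w (t - s)‖ ^ 2 :=
    integrable_smul_of_bounded (B := (B + B) ^ 2) ha (by fun_prop) fun x => by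
      rw [Real.norm_eq_abs, abs_of_nonneg (sq_nonneg _)]
      gcongr
      exact (norm_sub_le _ _).trans (add_le_add (hB _) (hB _))
  have i4 : Integrable fun s => a s • ‖w (t - s)‖ ^ 2 + a s * ‖w t‖ ^ 2 :=
    i2.add (ha.mul_const _)
  rw [real_inner_comm, ← integral_inner i1, ← integral_mul_const,
    ← integral_add i2 (ha.mul_const _), ← integral_sub i4 i3, ← integral_const_mul]
  congr 1
  ext s
  rw [real_inner_smul_right, real_inner_comm, inner_eq_half_norm_sq]
  simp only [smul_eq_mul]
  ring

theorem convolution_sub_eq {E : Type*} [NormedAddCommGroup E] [NormedSpace ℝ E] (k : ℝ → ℝ)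
    (f : ℝ → E) (t δ : ℝ) : (k ⋆[lsmul ℝ ℝ] f) (t - δ) = ∫ s, k (s - δ) • f (t - s) := by
  rw [convolution_lsmul, ← integral_sub_right_eq_self _ δ]
  congr 1
  ext s
  rw [show t - δ - (s - δ) = t - s by ring]

/-- The one-step form of the inequality `(∂ₜ(k * w), w) ≥ ½ ∂ₜ(k * ‖w‖²)`. -/
theorem half_sub_le_inner_sub_shift [CompleteSpace H] {k : ℝ → ℝ} (hk : IsCausalKernel k)
    {w : ℝ → H} (hw : Continuous w) {B : ℝ} (hB : ∀ x, ‖w x‖ ≤ B) {t δ C : ℝ} (hδ : 0 < δ)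
    (hC : ∀ s ∈ Ioc 0 δ, k s * ‖w t - w (t - s)‖ ^ 2 ≤ C) :
    (1 / 2) * ((k ⋆[lsmul ℝ ℝ] fun s => ‖w s‖ ^ 2) t -
        (k ⋆[lsmul ℝ ℝ] fun s => ‖w s‖ ^ 2) (t - δ)) - (1 / 2) * (C * δ) ≤
      inner ℝ ((k ⋆[lsmul ℝ ℝ] w) t - (k ⋆[lsmul ℝ ℝ] w) (t - δ)) (w t) := by
  have hkδ : Integrable fun s => k (s - δ) := hk.integrable.comp_sub_right δ
  rw [inner_sub_left, convolution_sub_eq, convolution_sub_eq, convolution_lsmul,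
    inner_integral_smul_shift hkδ hw hB]
  have e2 : (k ⋆[lsmul ℝ ℝ] w) t = ∫ s, k s • w (t - s) := convolution_lsmul
  rw [e2, inner_integral_smul_shift hk.integrable hw hB, integral_sub_right_eq_self k δ]
  have i3 : ∀ {a : ℝ → ℝ}, Integrable a → Integrable fun s => a s • ‖w t - w (t - s)‖ ^ 2 :=
    fun ha => integrable_smul_of_bounded (B := (B + B) ^ 2) ha (by fun_prop) fun x => by
      rw [Real.norm_eq_abs, abs_of_nonneg (sq_nonneg _)]
      gcongr
      exact (norm_sub_le _ _).trans (add_le_add (hB _) (hB _))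
  -- The coefficient `k(s) - k(s - δ)` is nonpositive off `(0, δ]`, so only that interval of length
  -- `δ` can cost anything.
  have hmain : (∫ s, k s • ‖w t - w (t - s)‖ ^ 2) - ∫ s, k (s - δ) • ‖w t - w (t - s)‖ ^ 2 ≤
      C * δ := by
    rw [← integral_sub (i3 hk.integrable) (i3 hkδ)]
    have hcd : C * δ = ∫ s, (Ioc 0 δ).indicator (fun _ => C) s := by
      rw [integral_indicator measurableSet_Ioc, setIntegral_const]
      simp [hδ.le, mul_comm]
    rw [hcd]
    refine integral_mono ((i3 hk.integrable).sub (i3 hkδ))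
      ((integrable_indicator_iff measurableSet_Ioc).2 (by simp)) fun s => ?_
    simp only [smul_eq_mul, ← sub_mul]
    by_cases hs : s ∈ Ioc 0 δ
    · rw [indicator_of_mem hs, hk.sub_shift_eq hs]
      exact hC s hs
    · rw [indicator_of_notMem hs]
      exact mul_nonpos_of_nonpos_of_nonneg (hk.sub_shift_nonpos hδ hs) (sq_nonneg _)
  linarith

theorem HasDerivAt.tendsto_left_difference {E : Type*} [NormedAddCommGroup E] [NormedSpace ℝ E]
    {P : ℝ → E} {p : E} {x : ℝ} (h : HasDerivAt P p x) :
    Tendsto (fun δ : ℝ => δ⁻¹ • (P x - P (x - δ))) (𝓝[>] 0) (𝓝 p) := by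
  have hneg : Tendsto (fun δ : ℝ => -δ) (𝓝[>] 0) (𝓝[≠] 0) := by
    refine tendsto_nhdsWithin_iff.2 ⟨?_, ?_⟩
    · have : Tendsto (fun δ : ℝ => -δ) (𝓝 0) (𝓝 (-0)) := tendsto_neg 0
      rw [neg_zero] at this
      exact this.mono_left nhdsWithin_le_nhds
    · filter_upwards [self_mem_nhdsWithin] with δ hδ
      exact neg_ne_zero.2 (ne_of_gt hδ)
  refine (h.tendsto_slope_zero.comp hneg).congr fun δ => ?_
  simp only [Function.comp_apply]
  rw [← sub_eq_add_neg, inv_neg, neg_smul, ← smul_neg, neg_sub]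

/-- If `k * l = 1` on `(0, T)` and `w = l * g`, then `½ (k * ‖w‖²)(T) ≤ ∫₀ᵀ (g, w)`. -/
theorem half_convolution_norm_sq_le_integral_inner [CompleteSpace H] {T : ℝ} (hT : 0 < T)
    {k l : ℝ → ℝ} (hk : IsCausalKernel k) (hl : IsCausalKernel l)
    (hkl : ∀ t ∈ Ioo 0 T, (k ⋆[lsmul ℝ ℝ] l) t = 1) {g : ℝ → H} (hg : Continuous g) {M : ℝ}
    (hM : ∀ x, ‖g x‖ ≤ M) {w : ℝ → H} (hw : w = (l ⋆[lsmul ℝ ℝ] (Ioo 0 T).indicator g)) :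
    (k ⋆[lsmul ℝ ℝ] w) T = ∫ t in (0 : ℝ)..T, (Ioo 0 T).indicator g t ∧
    (1 / 2) * (k ⋆[lsmul ℝ ℝ] fun s => ‖w s‖ ^ 2) T ≤ ∫ t in (0 : ℝ)..T, inner ℝ (g t) (w t) := by
  have hM0 : 0 ≤ M := (norm_nonneg _).trans (hM 0)
  set f := (Ioo 0 T).indicator g with hf
  have hfM : ∀ x, ‖f x‖ ≤ M := fun x => (norm_indicator_le_norm_self _ _).trans (hM x)
  have hfm : AEStronglyMeasurable f :=
    hg.aestronglyMeasurable.indicator measurableSet_Ioo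
  have hf0 : ∀ t ≤ 0, f t = 0 := fun t ht =>
    indicator_of_notMem (fun h => absurd h.1 (not_lt.2 ht)) _
  have hfi : Integrable f := by
    refine (integrable_indicator_iff measurableSet_Ioo).2 ?_
    exact Measure.integrableOn_of_bounded (M := M) (by simp) hg.aestronglyMeasurable
      (Eventually.of_forall hM)
  have hwc : Continuous w := hw ▸ continuous_convolution_of_bounded hl hfm hfM
  obtain ⟨B, hB⟩ : ∃ B, ∀ x, ‖w x‖ ≤ B :=
    ⟨_, fun x => hw ▸ norm_convolution_le hl.integrable hfM x⟩
  have hw0 : ∀ t ≤ 0, w t = 0 := fun t ht => by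
    rw [hw, convolution_eq_zero_of_nonpos hl.eq_zero hf0 ht]
  have hB2 : ∀ x, ‖‖w x‖ ^ 2‖ ≤ B ^ 2 := fun x => by
    rw [norm_pow, norm_norm]
    gcongr
    exact hB x
  set v := (k ⋆[lsmul ℝ ℝ] w) with hv
  set V := (k ⋆[lsmul ℝ ℝ] fun s => ‖w s‖ ^ 2) with hV
  have hvc : Continuous v := continuous_convolution_of_bounded hk hwc.aestronglyMeasurable hB
  have hVc : Continuous V :=
    continuous_convolution_of_bounded hk (by fun_prop) hB2
  have hV0 : V 0 = 0 :=
    convolution_eq_zero_of_nonpos hk.eq_zero (fun t ht => by simp [hw0 t ht]) le_rfl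
  set P : ℝ → H := fun x => ∫ s in (0 : ℝ)..x, f s with hP
  have hPc : Continuous P :=
    intervalIntegral.continuous_primitive (fun x y => hfi.intervalIntegrable) 0
  -- Associativity gives this only a.e. before `T`; continuity of both sides extends it to every
  -- time up to and including `T`.
  have hvP : ∀ t ≤ T, v t = P t := by
    have h1 : EqOn v P (Iio T) := by
      refine Measure.eqOn_open_of_ae_eq (μ := volume) ?_ isOpen_Iio hvc.continuousOn
        hPc.continuousOn
      refine (ae_restrict_iff' measurableSet_Iio).2 ?_
      rw [hv, hw]
      exact convolution_convolution_ae_eq_integral hk.integrable hk.eq_zero hl.integrable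
        hl.eq_zero hkl hfi hf0
    have h2 := h1.closure hvc hPc
    rw [closure_Iio] at h2
    exact h2
  refine ⟨hvP T le_rfl, ?_⟩
  set Q : ℝ → ℝ := fun x => ∫ s in (0 : ℝ)..x, V s with hQ
  have hQd : ∀ x, HasDerivAt Q (V x) x := fun x => hVc.integral_hasStrictDerivAt 0 x |>.hasDerivAt
  have hQ0 : Q 0 = 0 := intervalIntegral.integral_same
  set L : ℝ → ℝ := fun s => ∫ x in Ioc 0 s, l x with hL
  -- Integrating the increments `V(t) - V(t - δ)` over `(0, T)` telescopes to increments of the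
  -- primitive `Q` at `T` and at `0`. The quotients tend to `V(T)` and `V(0) = 0`.
  have hlim1 : Tendsto (fun δ : ℝ => (1 / 2) * (δ⁻¹ • (Q T - Q (T - δ)) - δ⁻¹ • (Q 0 - Q (0 - δ))) -
      2 * M ^ 2 * T * L δ) (𝓝[>] 0) (𝓝 ((1 / 2) * V T)) := by
    have := (((hQd T).tendsto_left_difference.sub (hQd 0).tendsto_left_difference).const_mul
      (1 / 2 : ℝ)).sub (hl.tendsto_setIntegral_zero.const_mul (2 * M ^ 2 * T))
    simpa [hV0] using this
  have hPlip : ∀ t δ : ℝ, 0 < δ → ‖δ⁻¹ • (P t - P (t - δ))‖ ≤ M := by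
    intro t δ hδ
    rw [hP]
    simp only
    rw [intervalIntegral.integral_interval_sub_left hfi.intervalIntegrable hfi.intervalIntegrable,
      norm_smul, Real.norm_of_nonneg (inv_nonneg.2 hδ.le)]
    have := intervalIntegral.norm_integral_le_of_norm_le_const (a := t - δ) (b := t)
      (f := f) (C := M) fun x _ => hfM x
    rw [sub_sub_cancel, abs_of_pos hδ] at this
    rw [inv_mul_le_iff₀ hδ]
    linarith
  have hlim2 : Tendsto (fun δ : ℝ => ∫ t in (0 : ℝ)..T, inner ℝ (δ⁻¹ • (v t - v (t - δ))) (w t))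
      (𝓝[>] 0) (𝓝 (∫ t in (0 : ℝ)..T, inner ℝ (g t) (w t))) := by
    refine intervalIntegral.tendsto_integral_filter_of_dominated_convergence (fun _ => M * B)
      (Eventually.of_forall fun δ => Continuous.aestronglyMeasurable (by fun_prop)) ?_
      (by simp) ?_
    · filter_upwards [self_mem_nhdsWithin] with δ hδ
      have hδ : 0 < δ := hδ
      refine Eventually.of_forall fun t ht => ?_
      rw [uIoc_of_le hT.le] at ht
      rw [hvP t ht.2, hvP (t - δ) (by linarith [ht.2])]
      exact (norm_inner_le_norm _ _).trans
        (mul_le_mul (hPlip t δ hδ) (hB t) (norm_nonneg _) hM0)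
    -- The truncation `f` may jump at `T`; before `T` it agrees locally with the continuous `g`, so
    -- `P` is differentiable there.
    · have hne : ∀ᵐ t : ℝ, t ≠ T := by simp [ae_iff]
      filter_upwards [hne] with t htT ht
      rw [uIoc_of_le hT.le] at ht
      have htT' : t < T := lt_of_le_of_ne ht.2 htT
      have hfg : f =ᶠ[𝓝 t] g := by
        filter_upwards [Ioo_mem_nhds ht.1 htT'] with x hx
        exact indicator_of_mem hx _
      have hd : HasDerivAt P (g t) t := by
        rw [← hfg.eq_of_nhds]
        exact intervalIntegral.integral_hasDerivAt_right hfi.intervalIntegrable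
          ⟨univ, univ_mem, hfm.restrict⟩ (hg.continuousAt.congr hfg.symm)
      refine ((hd.tendsto_left_difference).inner tendsto_const_nhds).congr' ?_
      filter_upwards [self_mem_nhdsWithin] with δ hδ
      have hδ : 0 < δ := hδ
      rw [hvP t ht.2, hvP (t - δ) (by linarith)]
  refine le_of_tendsto_of_tendsto hlim1 hlim2 ?_
  filter_upwards [Ioo_mem_nhdsGT hT] with δ hδ
  have hδ0 : 0 < δ := hδ.1
  have hstep : ∀ t, (1 / 2) * (V t - V (t - δ)) - 2 * M ^ 2 * L δ * δ ≤
      inner ℝ (v t - v (t - δ)) (w t) := by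
    intro t
    -- This `C` comes from `k(s) (2 M L(s))² = 4 M² L(s) (k(s) L(s)) ≤ 4 M² L(δ)`.
    have := half_sub_le_inner_sub_shift hk hwc hB (t := t) (C := 4 * M ^ 2 * L δ) hδ0 ?_
    · refine le_trans (le_of_eq ?_) this
      ring
    · intro s hs
      have hsm := norm_convolution_sub_shift_le hl hfm hfM t hs.1
      rw [← hw] at hsm
      have hkL : k s * L s ≤ 1 :=
        hk.mul_setIntegral_le_one hl (hkl s ⟨hs.1, hs.2.trans_lt hδ.2⟩)
      have hLs : 0 ≤ L s := hl.setIntegral_nonneg s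
      have hLL : L s ≤ L δ := hl.setIntegral_mono hs.2
      calc k s * ‖w t - w (t - s)‖ ^ 2 ≤ k s * (2 * M * L s) ^ 2 :=
            mul_le_mul_of_nonneg_left (pow_le_pow_left₀ (norm_nonneg _) hsm 2) (hk.nonneg s)
        _ = 4 * M ^ 2 * (L s * (k s * L s)) := by ring
        _ ≤ 4 * M ^ 2 * (L δ * 1) := by
            gcongr
            · exact mul_nonneg (hk.nonneg s) hLs
            · exact hLs.trans hLL
        _ = _ := by ring
  have hVshift : Continuous fun t => V (t - δ) := by fun_prop
  have hint := intervalIntegral.integral_mono_on (a := 0) (b := T) (μ := volume) hT.le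
    (Continuous.intervalIntegrable (by fun_prop) 0 T)
    (Continuous.intervalIntegrable (by fun_prop) 0 T) fun t _ => hstep t
  rw [intervalIntegral.integral_sub (Continuous.intervalIntegrable (by fun_prop) 0 T)
    (by simp), intervalIntegral.integral_const_mul,
    intervalIntegral.integral_sub (hVc.intervalIntegrable 0 T) (hVshift.intervalIntegrable 0 T),
    intervalIntegral.integral_comp_sub_right, intervalIntegral.integral_const] at hint
  have hQQ : ∫ t in (0 - δ)..(T - δ), V t = Q (T - δ) - Q (0 - δ) :=
    (intervalIntegral.integral_interval_sub_left (hVc.intervalIntegrable _ _)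
      (hVc.intervalIntegrable _ _)).symm
  rw [hQQ] at hint
  have hmul := mul_le_mul_of_nonneg_left hint (inv_nonneg.2 hδ0.le)
  simp_rw [real_inner_smul_left]
  rw [intervalIntegral.integral_const_mul]
  refine le_trans (le_of_eq ?_) hmul
  simp only [smul_eq_mul, hQ0, sub_zero]
  change _ = δ⁻¹ * (1 / 2 * (Q T - (Q (T - δ) - Q (0 - δ))) - T * (2 * M ^ 2 * L δ * δ))
  field_simp
  ring

end CoreInequality

/-! ### Coercivity in `L²(0, T; H)` -/

section Coercivity

variable {H : Type*} [NormedAddCommGroup H] [InnerProductSpace ℝ H]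

theorem L2Space.inner_const {T : ℝ} (f : L2Space T H) (a : H) :
    inner ℝ f (Lp.const 2 (volume.restrict (Ioo 0 T)) a) = ∫ t in Ioo 0 T, inner ℝ (f t) a := by
  rw [L2.inner_def]
  refine integral_congr_ae ?_
  filter_upwards [Lp.coeFn_const (μ := volume.restrict (Ioo 0 T)) (p := 2) a] with t ht
  rw [ht]
  rfl

theorem L2Space.norm_sq {T : ℝ} (f : L2Space T H) : ‖f‖ ^ 2 = ∫ t in Ioo 0 T, ‖f t‖ ^ 2 := by
  rw [← real_inner_self_eq_norm_sq, L2.inner_def]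
  simp only [real_inner_self_eq_norm_sq]

/-- Coercivity of `g ↦ ∫₀ᵀ (g, l * g)`. -/
theorem convL2_coercive [CompleteSpace H] {T : ℝ} (hT : 0 < T) {k l : ℝ → ℝ}
    (hk : IsCausalKernel k) (hl : IsCausalKernel l)
    (hkl : ∀ t ∈ Ioo 0 T, (k ⋆[lsmul ℝ ℝ] l) t = 1) {κ : ℝ} (hκ : ∀ t ∈ Ioo 0 T, κ ≤ k t)
    (g : L2Space T H) :
    κ * ‖convL2 T H l hl.integrable g‖ ^ 2 ≤ 2 * inner ℝ g (convL2 T H l hl.integrable g) ∧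
      ∀ a : H, 2 * inner ℝ g (Lp.const 2 (volume.restrict (Ioo 0 T)) a) ≤
        2 * inner ℝ g (convL2 T H l hl.integrable g) + (∫ s, k s) * ‖a‖ ^ 2 := by
  set A := convL2 T H l hl.integrable
  have hclosed : IsClosed {g : L2Space T H | κ * ‖A g‖ ^ 2 ≤ 2 * inner ℝ g (A g) ∧
      ∀ a : H, 2 * inner ℝ g (Lp.const 2 (volume.restrict (Ioo 0 T)) a) ≤
        2 * inner ℝ g (A g) + (∫ s, k s) * ‖a‖ ^ 2} := by
    -- Both inequalities are closed conditions on `g`, so smooth compactly supported `g` suffice.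
    rw [ofPred_and, ofPred_forall]
    refine IsClosed.inter (isClosed_le (by fun_prop) (by fun_prop))
      (isClosed_iInter fun a => isClosed_le (by fun_prop) (by fun_prop))
  refine (hclosed.closure_subset_iff.2 ?_)
    ((Lp.dense_hasCompactSupport_contDiff (F := H) (μ := volume.restrict (Ioo 0 T))
      (p := 2) (by norm_num)) g)
  rintro g ⟨g₀, hgg, hcs, hcd⟩
  have hg : Continuous g₀ := hcd.continuous
  obtain ⟨M, hM⟩ := hcs.exists_bound_of_continuous hg
  have hfi : (Ioo 0 T).indicator g =ᵐ[volume] (Ioo 0 T).indicator g₀ := indicator_ae_eq hgg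
  set w := (l ⋆[lsmul ℝ ℝ] (Ioo 0 T).indicator g₀) with hw
  have hfM : ∀ x, ‖(Ioo 0 T).indicator g₀ x‖ ≤ M := fun x =>
    (norm_indicator_le_norm_self _ _).trans (hM x)
  have hwc : Continuous w :=
    continuous_convolution_of_bounded hl (hg.aestronglyMeasurable.indicator measurableSet_Ioo) hfM
  have hB : ∀ x, ‖w x‖ ≤ (∫ x, ‖l x‖) * M := norm_convolution_le hl.integrable hfM
  have hAw : A g =ᵐ[volume.restrict (Ioo 0 T)] w := by
    refine (convL2_ae_eq hl.integrable g).trans (Eventually.of_forall fun t => ?_)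
    rw [convolution_congr (lsmul ℝ ℝ) (ae_eq_refl l) hfi]
  obtain ⟨hv, hV⟩ := half_convolution_norm_sq_le_integral_inner hT hk hl hkl hg hM hw
  have hX : inner ℝ g (A g) = ∫ t in (0 : ℝ)..T, inner ℝ (g₀ t) (w t) := by
    rw [L2.inner_def, intervalIntegral.integral_of_le hT.le, integral_Ioc_eq_integral_Ioo]
    refine integral_congr_ae ?_
    filter_upwards [hgg, hAw] with t h1 h2
    rw [h1, h2]
  have hAn : ‖A g‖ ^ 2 = ∫ s in Ioo 0 T, ‖w s‖ ^ 2 := by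
    rw [L2Space.norm_sq]
    refine integral_congr_ae ?_
    filter_upwards [hAw] with t h2
    rw [h2]
  have i2 : Integrable fun s => k s • ‖w (T - s)‖ ^ 2 :=
    integrable_smul_of_bounded (B := ((∫ x, ‖l x‖) * M) ^ 2) hk.integrable (by fun_prop)
      fun x => by
        rw [Real.norm_eq_abs, abs_of_nonneg (sq_nonneg _)]
        gcongr
        exact hB _
  rw [← hX] at hV
  constructor
  · refine le_trans ?_ ((by linarith : (k ⋆[lsmul ℝ ℝ] fun s => ‖w s‖ ^ 2) T ≤ _))
    rw [convolution_lsmul_swap, hAn, ← integral_const_mul, ← integral_indicator measurableSet_Ioo]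
    refine integral_mono ?_ (by simpa using i2.comp_sub_left T) fun s => ?_
    · refine (integrable_indicator_iff measurableSet_Ioo).2 ?_
      exact (Continuous.integrableOn_Icc (by fun_prop)).mono_set Ioo_subset_Icc_self
    · by_cases hs : s ∈ Ioo 0 T
      · rw [indicator_of_mem hs, smul_eq_mul]
        exact mul_le_mul_of_nonneg_right (hκ _ ⟨by linarith [hs.2], by linarith [hs.1]⟩)
          (sq_nonneg _)
      · rw [indicator_of_notMem hs]
        exact mul_nonneg (hk.nonneg _) (sq_nonneg _)
  · intro a
    -- Since `k * w = 1 * g` at `T`, pairing `g` with a constant becomes pairing `(k * w)(T)` with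
    -- it, which the energy controls.
    have hga : inner ℝ g (Lp.const 2 (volume.restrict (Ioo 0 T)) a) =
        inner ℝ ((k ⋆[lsmul ℝ ℝ] w) T) a := by
      rw [L2Space.inner_const, hv, intervalIntegral.integral_of_le hT.le,
        integral_Ioc_eq_integral_Ioo, setIntegral_congr_fun measurableSet_Ioo
          (fun t ht => indicator_of_mem ht g₀), real_inner_comm, ← integral_inner]
      · refine integral_congr_ae ?_
        filter_upwards [hgg] with t ht
        rw [ht, real_inner_comm]
      · exact (Lp.memLp g).integrable (by norm_num) |>.congr hgg
    rw [hga]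
    have i1 : Integrable fun s => k s • w (T - s) :=
      integrable_smul_of_bounded hk.integrable (by fun_prop) fun x => hB (T - x)
    have hle : 2 * inner ℝ ((k ⋆[lsmul ℝ ℝ] w) T) a ≤
        (k ⋆[lsmul ℝ ℝ] fun s => ‖w s‖ ^ 2) T + (∫ s, k s) * ‖a‖ ^ 2 := by
      rw [convolution_lsmul, convolution_lsmul, real_inner_comm, ← integral_inner i1,
        ← integral_const_mul, ← integral_mul_const, ← integral_add i2 (hk.integrable.mul_const _)]
      refine integral_mono ((i1.const_inner a).const_mul 2)
        (i2.add (hk.integrable.mul_const _)) fun s => ?_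
      simp only [real_inner_smul_right, smul_eq_mul]
      have h1 := inner_eq_half_norm_sq a (w (T - s))
      have h2 := sq_nonneg ‖w (T - s) - a‖
      have h3 : 2 * inner ℝ a (w (T - s)) ≤ ‖w (T - s)‖ ^ 2 + ‖a‖ ^ 2 := by linarith
      have := mul_le_mul_of_nonneg_left h3 (hk.nonneg s)
      linarith
    linarith

end Coercivity

/-! ### Weak derivatives and primitives -/

section WeakDeriv

variable {E : Type*} [NormedAddCommGroup E] [NormedSpace ℝ E]

/-- A test function on `(0, T)` with zero mean is the derivative of a test function. -/
theorem exists_testFunction_deriv_eq {T : ℝ} {χ : ℝ → ℝ} (hχ : ContDiff ℝ ∞ χ)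
    {S : Set ℝ} (hS : IsCompact S) (hne : S.Nonempty) (hST : S ⊆ Ioo 0 T)
    (hsupp : ∀ x ∉ S, χ x = 0) (h0 : ∫ x, χ x = 0) :
    ∃ ψ : ℝ → ℝ, ContDiff ℝ ∞ ψ ∧ HasCompactSupport ψ ∧ tsupport ψ ⊆ Ioo 0 T ∧ deriv ψ = χ := by
  set ψ : ℝ → ℝ := fun t => ∫ s in (0 : ℝ)..t, χ s with hψ
  have hd : ∀ t, HasDerivAt ψ (χ t) t := fun t =>
    (hχ.continuous.integral_hasStrictDerivAt 0 t).hasDerivAt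
  have hderiv : deriv ψ = χ := funext fun t => (hd t).deriv
  have hα := hST (hS.sInf_mem hne)
  have hβ := hST (hS.sSup_mem hne)
  have hsub : S ⊆ Icc (sInf S) (sSup S) := fun x hx =>
    ⟨csInf_le hS.bddBelow hx, le_csSup hS.bddAbove hx⟩
  have hzero : ∀ t ∉ Icc (sInf S) (sSup S), ψ t = 0 := by
    intro t ht
    by_cases h1 : t < sInf S
    · refine intervalIntegral.integral_zero_ae
        (Eventually.of_forall fun x hx => hsupp x fun hxS => ?_)
      have h2 := (hsub hxS).1
      have h3 := hα.1
      rcases le_total 0 t with h | h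
      · rw [uIoc_of_le h] at hx
        linarith [hx.2]
      · rw [uIoc_of_ge h] at hx
        linarith [hx.2]
    · have h2 : sSup S < t := not_le.1 fun h => ht ⟨not_lt.1 h1, h⟩
      have ht0 : 0 ≤ t := (hβ.1.trans h2).le
      -- To the right of `S` the primitive already equals the full integral, which is zero.
      rw [← h0, hψ]
      simp only
      rw [intervalIntegral.integral_of_le ht0, ← integral_indicator measurableSet_Ioc]
      congr 1
      ext x
      by_cases hx : x ∈ Ioc 0 t
      · rw [indicator_of_mem hx]
      · rw [indicator_of_notMem hx, hsupp x fun hxS => hx ⟨(hST hxS).1, ((hsub hxS).2.trans h2.le)⟩]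
  have hts : tsupport ψ ⊆ Icc (sInf S) (sSup S) :=
    closure_minimal (fun x hx => by_contra fun h => hx (hzero x h)) isClosed_Icc
  refine ⟨ψ, contDiff_infty_iff_deriv.2 ⟨fun t => (hd t).differentiableAt, hderiv ▸ hχ⟩,
    isCompact_Icc.of_isClosed_subset (isClosed_tsupport _) hts,
    hts.trans (Icc_subset_Ioo hα.1 hβ.2), hderiv⟩

/-- The lemma of du Bois-Reymond: a function with vanishing weak derivative is constant. -/
theorem ae_eq_const_of_integral_deriv_smul_eq_zero [CompleteSpace E] {T : ℝ} (hT : 0 < T)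
    {d : ℝ → E} (hd : IntegrableOn d (Ioo 0 T))
    (h : ∀ ψ : ℝ → ℝ, ContDiff ℝ ∞ ψ → HasCompactSupport ψ → tsupport ψ ⊆ Ioo 0 T →
      ∫ t in Ioo 0 T, deriv ψ t • d t = 0) :
    ∃ c : E, ∀ᵐ t, t ∈ Ioo 0 T → d t = c := by
  let b : ContDiffBump (T / 2) :=
    { rIn := T / 8, rOut := T / 4, rIn_pos := by positivity, rIn_lt_rOut := by linarith }
  set η : ℝ → ℝ := b.normed volume with hη
  have hηc : ContDiff ℝ ∞ η := b.contDiff_normed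
  have hη1 : ∫ x, η x = 1 := b.integral_normed
  have hηs : tsupport η = Metric.closedBall (T / 2) (T / 4) := b.tsupport_normed_eq
  have hηT : tsupport η ⊆ Ioo 0 T := by
    rw [hηs, Real.closedBall_eq_Icc]
    exact Icc_subset_Ioo (by linarith) (by linarith)
  have hηk : IsCompact (tsupport η) := by rw [hηs]; exact isCompact_closedBall _ _
  have hηn : (tsupport η).Nonempty := by
    rw [hηs]; exact Metric.nonempty_closedBall.2 (by positivity)
  have hint : ∀ {ψ : ℝ → ℝ}, Continuous ψ → HasCompactSupport ψ →
      IntegrableOn (fun t => ψ t • d t) (Ioo 0 T) := fun {ψ} hc hcs => by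
    obtain ⟨C, hC⟩ := hcs.exists_bound_of_continuous hc
    exact hd.bdd_smul C hc.aestronglyMeasurable (Eventually.of_forall hC)
  set c := ∫ t in Ioo 0 T, η t • d t with hc
  refine ⟨c, ?_⟩
  have key : ∀ ψ : ℝ → ℝ, ContDiff ℝ ∞ ψ → HasCompactSupport ψ → tsupport ψ ⊆ Ioo 0 T →
      ∫ t, ψ t • (Ioo 0 T).indicator (fun t => d t - c) t = 0 := by
    intro ψ hψ hψk hψT
    have hψi : Integrable ψ := hψ.continuous.integrable_of_hasCompactSupport hψk
    have hηi : Integrable η := hηc.continuous.integrable_of_hasCompactSupport hηk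
    -- Subtracting `(∫ ψ) η`, with `∫ η = 1`, makes the mean zero; the constant is thus the
    -- `η`-weighted mean `c` of `d`.
    obtain ⟨Ψ, h1, h2, h3, h4⟩ := exists_testFunction_deriv_eq (T := T)
      (χ := fun t => ψ t - (∫ x, ψ x) * η t) (hψ.sub (contDiff_const.mul hηc))
      (hψk.isCompact.union hηk) (hηn.inr) (union_subset hψT hηT)
      (fun x hx => by
        rw [image_eq_zero_of_notMem_tsupport fun h' => hx (Or.inl h'),
          image_eq_zero_of_notMem_tsupport fun h' => hx (Or.inr h'), mul_zero, sub_zero])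
      (by rw [integral_sub hψi (hηi.const_mul _), integral_const_mul, hη1, mul_one, sub_self])
    have h5 := h Ψ h1 h2 h3
    rw [h4] at h5
    simp only [sub_smul, mul_smul] at h5
    have hi2 : IntegrableOn (fun t => (∫ x, ψ x) • η t • d t) (Ioo 0 T) :=
      (hint hηc.continuous hηk).smul (∫ x, ψ x)
    rw [integral_sub (hint hψ.continuous hψk) hi2, integral_smul, ← hc, sub_eq_zero] at h5
    have e : (fun t => ψ t • (Ioo 0 T).indicator (fun t => d t - c) t) =
        (Ioo 0 T).indicator fun t => ψ t • d t - ψ t • c := by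
      ext t
      by_cases ht : t ∈ Ioo 0 T
      · simp [ht, smul_sub]
      · simp [ht]
    rw [e, integral_indicator measurableSet_Ioo, integral_sub (hint hψ.continuous hψk)
      (hψi.integrableOn.smul_const c), h5, integral_smul_const,
      setIntegral_eq_integral_of_forall_compl_eq_zero, sub_self]
    exact fun x hx => image_eq_zero_of_notMem_tsupport fun h' => hx (hψT h')
  have hloc : LocallyIntegrableOn ((Ioo 0 T).indicator fun t => d t - c) (Ioo 0 T) := by
    refine (Integrable.integrableOn ?_).locallyIntegrableOn
    exact (integrable_indicator_iff measurableSet_Ioo).2 (hd.sub (integrableOn_const (by simp)))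
  filter_upwards [isOpen_Ioo.ae_eq_zero_of_integral_contDiff_smul_eq_zero hloc key] with t ht htT
  have := ht htT
  rw [indicator_of_mem htT] at this
  exact sub_eq_zero.1 this

/-- The primitive of an integrable function has that function as weak derivative. -/
theorem integral_deriv_smul_primitive [CompleteSpace E] {T : ℝ} {g : ℝ → E}
    (hg : IntegrableOn g (Ioo 0 T)) {ψ : ℝ → ℝ} (hψ : ContDiff ℝ ∞ ψ)
    (hψk : HasCompactSupport ψ) (hψT : tsupport ψ ⊆ Ioo 0 T) :
    ∫ t in Ioo 0 T, deriv ψ t • ∫ s in (0 : ℝ)..t, g s = -∫ t in Ioo 0 T, ψ t • g t := by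
  have hd : Continuous (deriv ψ) := hψ.continuous_deriv (by simp)
  obtain ⟨C, hC⟩ := hψk.deriv.exists_bound_of_continuous hd
  set μ := volume.restrict (Ioo 0 T) with hμ
  -- Fubini on the triangle `s < t` replaces integration by parts, as `g` is merely integrable.
  set F : ℝ → ℝ → E := fun t s => (Ioi s).indicator (deriv ψ) t • g s with hF
  have hFi : Integrable (Function.uncurry F) (μ.prod μ) := by
    have h1 : Integrable (fun p : ℝ × ℝ => g p.2) (μ.prod μ) := Integrable.comp_snd hg μ
    refine h1.bdd_smul (φ := fun p : ℝ × ℝ => (Ioi p.2).indicator (deriv ψ) p.1) C ?_ ?_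
    · have : (fun p : ℝ × ℝ => (Ioi p.2).indicator (deriv ψ) p.1) =
          {p : ℝ × ℝ | p.2 < p.1}.indicator fun p => deriv ψ p.1 := by
        ext p
        simp [indicator]
      rw [this]
      exact (hd.comp continuous_fst).aestronglyMeasurable.indicator
        (measurableSet_lt measurable_snd measurable_fst)
    · exact Eventually.of_forall fun p => (norm_indicator_le_norm_self _ _).trans (hC _)
  have hswap := integral_integral_swap hFi
  have e1 : ∀ t ∈ Ioo 0 T, ∫ s, F t s ∂μ = deriv ψ t • ∫ s in (0 : ℝ)..t, g s := by
    intro t ht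
    rw [intervalIntegral.integral_of_le ht.1.le, integral_Ioc_eq_integral_Ioo, ← integral_smul,
      hμ, ← integral_indicator measurableSet_Ioo, ← integral_indicator measurableSet_Ioo]
    congr 1
    ext s
    by_cases h0 : 0 < s
    · by_cases h1 : s < t
      · simp [hF, indicator, h0, h1, h1.trans ht.2]
      · simp [hF, indicator, h1]
    · simp [indicator, h0]
  have e2 : ∀ s ∈ Ioo 0 T, ∫ t, F t s ∂μ = -(ψ s • g s) := by
    intro s hs
    have h1 : ∫ t, (Ioi s).indicator (deriv ψ) t ∂μ = ∫ t in s..T, deriv ψ t := by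
      rw [hμ, intervalIntegral.integral_of_le hs.2.le, integral_Ioc_eq_integral_Ioo,
        ← integral_indicator measurableSet_Ioo, ← integral_indicator measurableSet_Ioo]
      congr 1
      ext t
      by_cases h1 : s < t
      · simp [indicator, h1, hs.1.trans h1]
      · simp [indicator, h1]
    have h2 : ∫ t in s..T, deriv ψ t = -ψ s := by
      rw [intervalIntegral.integral_deriv_eq_sub
        (fun x _ => (hψ.differentiable (by simp)).differentiableAt) (hd.intervalIntegrable _ _),
        image_eq_zero_of_notMem_tsupport fun h' => lt_irrefl _ (hψT h').2, zero_sub]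
    rw [hF]
    simp only
    rw [integral_smul_const, h1, h2, neg_smul]
  rw [setIntegral_congr_fun measurableSet_Ioo e1, setIntegral_congr_fun measurableSet_Ioo e2,
    integral_neg] at hswap
  exact hswap

end WeakDeriv

/-! ### Strong solutions as `u₀ + ℓ * g` -/

section Representation

variable {H : Type*} [NormedAddCommGroup H]

/-- A function in `W^{1,2}(0, T; H)` with initial value zero is the primitive of its weak
derivative. -/
theorem HasWeakDeriv.ae_eq_primitive [NormedSpace ℝ H] [CompleteSpace H] {T : ℝ} (hT : 0 < T)
    {v : ℝ → H}
    (hv : MemLp v 2 (volume.restrict (Ioo 0 T))) (h0 : HasInitialValue T v 0) {g : L2Space T H}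
    (hg : HasWeakDeriv T v g) : ∀ᵐ t, t ∈ Ioo 0 T → v t = ∫ s in (0 : ℝ)..t, g s := by
  have hgi : IntegrableOn g (Ioo 0 T) := (Lp.memLp g).integrable (by norm_num)
  have hvi : IntegrableOn v (Ioo 0 T) := hv.integrable (by norm_num)
  have hGc : ContinuousOn (fun t => ∫ s in (0 : ℝ)..t, g s) (Icc 0 T) :=
    uIcc_of_le hT.le ▸ intervalIntegral.continuousOn_primitive_interval
      (by rw [uIcc_of_le hT.le]; exact (integrableOn_Icc_iff_integrableOn_Ioo).2 hgi)
  have hGi : IntegrableOn (fun t => ∫ s in (0 : ℝ)..t, g s) (Ioo 0 T) :=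
    hGc.integrableOn_Icc.mono_set Ioo_subset_Icc_self
  obtain ⟨c, hc⟩ := ae_eq_const_of_integral_deriv_smul_eq_zero hT (hvi.sub hGi)
    fun ψ hψ hψk hψT => by
      have hd : Continuous (deriv ψ) := hψ.continuous_deriv (by simp)
      obtain ⟨C, hC⟩ := hψk.deriv.exists_bound_of_continuous hd
      have hi : ∀ {w : ℝ → H}, IntegrableOn w (Ioo 0 T) →
          IntegrableOn (fun t => deriv ψ t • w t) (Ioo 0 T) := fun hw =>
        hw.bdd_smul C hd.aestronglyMeasurable (Eventually.of_forall hC)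
      simp only [Pi.sub_apply, smul_sub]
      rw [integral_sub (hi hvi) (hi hGi), hg ψ hψ hψk hψT,
        integral_deriv_smul_primitive hgi hψ hψk hψT, sub_self]
  obtain ⟨w, hwc, hvw, hw0⟩ := h0
  have hEq : EqOn (fun t => w t - ∫ s in (0 : ℝ)..t, g s) (fun _ => c) (Ioo 0 T) := by
    refine Measure.eqOn_open_of_ae_eq (μ := volume) ?_ isOpen_Ioo
      ((hwc.sub hGc).mono Ioo_subset_Icc_self) continuousOn_const
    filter_upwards [hvw, (ae_restrict_iff' measurableSet_Ioo).2 hc] with t h1 h2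
    rw [← h1]
    exact h2
  have hEq' := hEq.of_subset_closure (hwc.sub hGc) continuousOn_const Ioo_subset_Icc_self
    (by rw [closure_Ioo hT.ne])
  -- The continuous representative fixes the constant: both it and the primitive vanish at `0`.
  have hc0 : c = 0 := by
    have := hEq' (left_mem_Icc.2 hT.le)
    simpa [hw0] using this.symm
  filter_upwards [hc] with t ht htT
  have := ht htT
  rw [hc0] at this
  exact sub_eq_zero.1 this

/-- Integrable functions with the same primitive on `(-∞, T)` coincide there. -/
theorem ae_eq_of_ae_primitive_eq [NormedSpace ℝ H] [CompleteSpace H] {T : ℝ} {f f' : ℝ → H}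
    (hf : Integrable f)
    (hf' : Integrable f')
    (h : ∀ᵐ t, t < T → ∫ s in (0 : ℝ)..t, f s = ∫ s in (0 : ℝ)..t, f' s) :
    ∀ᵐ t, t < T → f t = f' t := by
  have hc : ∀ {f : ℝ → H}, Integrable f → Continuous fun t => ∫ s in (0 : ℝ)..t, f s := fun hf =>
    intervalIntegral.continuous_primitive (fun x y => hf.intervalIntegrable) 0
  have hEq : EqOn (fun t => ∫ s in (0 : ℝ)..t, f s) (fun t => ∫ s in (0 : ℝ)..t, f' s) (Iio T) :=
    Measure.eqOn_open_of_ae_eq (μ := volume) ((ae_restrict_iff' measurableSet_Iio).2 h) isOpen_Iio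
      (hc hf).continuousOn (hc hf').continuousOn
  filter_upwards [LocallyIntegrable.ae_hasDerivAt_integral hf.locallyIntegrable,
    LocallyIntegrable.ae_hasDerivAt_integral hf'.locallyIntegrable] with t h1 h2 htT
  exact (h1 0).unique ((h2 0).congr_of_eventuallyEq
    (hEq.eventuallyEq_of_mem (Iio_mem_nhds htT)))

/-- If `k * l = 1` on `(0, T)` and `k * w` is the primitive of `g`, then `w = l * g`. -/
theorem ae_eq_convolution_of_convolution_eq_primitive [NormedSpace ℝ H] [CompleteSpace H]
    {T : ℝ} {k l : ℝ → ℝ} (hk : IsCausalKernel k) (hl : IsCausalKernel l)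
    (hkl : ∀ t ∈ Ioo 0 T, (k ⋆[lsmul ℝ ℝ] l) t = 1) {w g : ℝ → H} (hw : Integrable w)
    (hw0 : ∀ t ≤ 0, w t = 0) (hg : Integrable g) (hg0 : ∀ t ≤ 0, g t = 0)
    (h : ∀ᵐ t, t ∈ Ioo 0 T → (k ⋆[lsmul ℝ ℝ] w) t = ∫ s in (0 : ℝ)..t, g s) :
    ∀ᵐ t, t < T → w t = (l ⋆[lsmul ℝ ℝ] g) t := by
  set one : ℝ → ℝ := (Ioo 0 T).indicator fun _ => (1 : ℝ) with hone
  have honei : Integrable one :=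
    (integrable_indicator_iff measurableSet_Ioo).2 (integrableOn_const (by simp))
  have hone0 : ∀ t ≤ 0, one t = 0 := fun t ht =>
    indicator_of_notMem (fun h => absurd h.1 (not_lt.2 ht)) _
  have hkw : ∀ᵐ t, t < T → (k ⋆[lsmul ℝ ℝ] w) t = (one ⋆[lsmul ℝ ℝ] g) t := by
    filter_upwards [h] with t ht htT
    rcases le_or_gt t 0 with h0 | h0
    · rw [convolution_eq_zero_of_nonpos hk.eq_zero hw0 h0,
        convolution_eq_zero_of_nonpos hone0 hg0 h0]
    · rw [ht ⟨h0, htT⟩, convolution_one_eq_integral hg0 htT.le]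
  -- Compare primitives: `1 * w = ℓ * (k * w) = ℓ * (1 * g) = 1 * (ℓ * g)`.
  refine ae_eq_of_ae_primitive_eq hw (hl.integrable.integrable_convolution _ hg) ?_
  filter_upwards [convolution_convolution_ae_eq_integral hl.integrable hl.eq_zero hk.integrable
    hk.eq_zero (fun t ht => by rw [convolution_comm]; exact hkl t ht) hw hw0,
    convolution_assoc_ae hl.integrable honei hg, convolution_assoc_ae honei hl.integrable hg]
    with t h1 h2 h3 htT
  rw [← h1 htT, convolution_congr_right_of_causal hl.eq_zero hkw htT.le, ← h2, convolution_comm l,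
    h3, convolution_one_eq_integral (fun t ht =>
      convolution_eq_zero_of_nonpos hl.eq_zero hg0 ht) htT.le]

theorem IsPCPair.convolution_eq_one {k l : ℝ → ℝ} (h : IsPCPair k l) {T t : ℝ}
    (ht : t ∈ Ioo 0 T) :
    ((Ioo 0 T).indicator k ⋆[lsmul ℝ ℝ] (Ioo 0 T).indicator l) t = 1 := by
  rw [convolution_indicator_eq_timeConv k l ht, h.conv_eq_one t ht.1]

variable [InnerProductSpace ℝ H]

/-- A strong solution is `u = u₀ + ℓ * g`, where `g = f - ξ` is the weak derivative of
`k * (u - u₀)`. -/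
theorem IsStrongSolutionPair.exists_eq_convL2 [CompleteSpace H] {T : ℝ} (hT : 0 < T)
    {k l : ℝ → ℝ} (hkl : IsPCPair k l) {φ : ℝ → H → EReal} {u₀ : H} {f u ξ : L2Space T H}
    (h : IsStrongSolutionPair T k φ u₀ f u ξ) :
    ∃ g : L2Space T H, g + ξ = f ∧
      u = Lp.const 2 (volume.restrict (Ioo 0 T)) u₀ +
        convL2 T H ((Ioo 0 T).indicator l) (hkl.right.isCausalKernel T).integrable g := by
  obtain ⟨g, hg, hgξ⟩ := h.equation
  refine ⟨g, Lp.ext ((Lp.coeFn_add g ξ).trans hgξ), ?_⟩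
  have hprim := hg.ae_eq_primitive hT h.memW12.1 h.initial
  have hzero : ∀ {w : ℝ → H}, ∀ t ≤ 0, (Ioo 0 T).indicator w t = 0 := fun {w} t ht =>
    indicator_of_notMem (fun h => absurd h.1 (not_lt.2 ht)) _
  have hwi : Integrable ((Ioo 0 T).indicator fun s => u s - u₀) := by
    refine (integrable_indicator_iff measurableSet_Ioo).2 (Integrable.sub ?_ ?_)
    · exact (Lp.memLp u).integrable (by norm_num)
    · exact integrableOn_const (by simp)
  have key := ae_eq_convolution_of_convolution_eq_primitive (hkl.left.isCausalKernel T)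
    (hkl.right.isCausalKernel T) (fun t ht => hkl.convolution_eq_one ht) hwi hzero
    (indicator_Lp_integrable g) hzero (by
      filter_upwards [hprim] with t ht htT
      rw [convolution_indicator_eq_timeConv _ _ htT, ht htT]
      refine intervalIntegral.integral_congr_ae (Eventually.of_forall fun s hs => ?_)
      rw [uIoc_of_le htT.1.le] at hs
      rw [indicator_of_mem (show s ∈ Ioo 0 T from ⟨hs.1, hs.2.trans_lt htT.2⟩)])
  refine Lp.ext ?_
  filter_upwards [Lp.coeFn_add (Lp.const 2 (volume.restrict (Ioo 0 T)) u₀)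
      (convL2 T H ((Ioo 0 T).indicator l) (hkl.right.isCausalKernel T).integrable g),
    Lp.coeFn_const (μ := volume.restrict (Ioo 0 T)) (p := 2) u₀,
    convL2_ae_eq (hkl.right.isCausalKernel T).integrable g, ae_restrict_of_ae key,
    ae_restrict_mem measurableSet_Ioo] with t h1 h2 h3 h4 h5
  have h6 := h4 h5.2
  rw [indicator_of_mem h5] at h6
  rw [h1, Pi.add_apply, h2, h3, ← h6]
  simp

/-- Subdifferentials are monotone. -/
theorem inner_sub_nonneg_of_mem_subdiff {φ : H → EReal} (hφ : ∀ x, φ x ≠ ⊥) {x y ξ η : H}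
    (hx : x ∈ effDomain φ) (hy : y ∈ effDomain φ) (hξ : ξ ∈ subdiff φ x) (hη : η ∈ subdiff φ y) :
    0 ≤ inner ℝ (ξ - η) (x - y) := by
  have h1 := hξ y hy
  have h2 := hη x hx
  lift φ x to ℝ using ⟨ne_of_lt hx, hφ x⟩ with a
  lift φ y to ℝ using ⟨ne_of_lt hy, hφ y⟩ with b
  rw [← EReal.coe_sub, EReal.coe_le_coe_iff] at h1 h2
  rw [inner_sub_left, ← neg_sub y x, inner_neg_right, neg_sub]
  linarith

end Representation

/-! ### Continuous dependence on the data -/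

section Dependence

variable {H : Type*} [NormedAddCommGroup H] [InnerProductSpace ℝ H]

theorem L2Space.norm_sq_const {T : ℝ} (hT : 0 < T) (a : H) :
    ‖Lp.const 2 (volume.restrict (Ioo 0 T)) a‖ ^ 2 = T * ‖a‖ ^ 2 := by
  rw [L2Space.norm_sq, integral_congr_ae (g := fun _ => ‖a‖ ^ 2)]
  · simp [hT.le]
  · filter_upwards [Lp.coeFn_const (μ := volume.restrict (Ioo 0 T)) (p := 2) a] with t ht
    rw [ht]
    rfl

theorem IsStrongSolutionPair.inner_sub_nonneg {T : ℝ} {k : ℝ → ℝ} {φ : ℝ → H → EReal}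
    (hφ : ∀ t ∈ Icc 0 T, IsProperLscConvex (φ t)) {u₀₁ u₀₂ : H} {f₁ f₂ u₁ u₂ ξ₁ ξ₂ : L2Space T H}
    (h₁ : IsStrongSolutionPair T k φ u₀₁ f₁ u₁ ξ₁) (h₂ : IsStrongSolutionPair T k φ u₀₂ f₂ u₂ ξ₂) :
    0 ≤ inner ℝ (ξ₁ - ξ₂) (u₁ - u₂) := by
  rw [L2.inner_def]
  refine integral_nonneg_of_ae ?_
  filter_upwards [Lp.coeFn_sub ξ₁ ξ₂, Lp.coeFn_sub u₁ u₂, h₁.mem_domain, h₂.mem_domain,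
    h₁.selection, h₂.selection, ae_restrict_mem measurableSet_Ioo] with t e1 e2 d1 d2 s1 s2 ht
  rw [e1, e2]
  exact inner_sub_nonneg_of_mem_subdiff (hφ t (Ioo_subset_Icc_self ht)).ne_bot d1.1 d2.1 s1 s2

/-- Monotonicity reads `X + (g, C) ≤ (h, C) + (h, w)` with `X = (g, w)` and `C` the constant
function `a`. Of the right-hand bounds, `X / 4` comes from `-(g, C)` and `X / 2` from `(h, w)`, so a
quarter of `X` survives absorption. -/
theorem IsStrongSolutionPair.norm_sub_sq_le [CompleteSpace H] {T : ℝ} (hT : 0 < T) {k l : ℝ → ℝ}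
    (hkl : IsPCPair k l) {φ : ℝ → H → EReal} (hφ : ∀ t ∈ Icc 0 T, IsProperLscConvex (φ t))
    {u₀₁ u₀₂ : H} {f₁ f₂ u₁ u₂ ξ₁ ξ₂ : L2Space T H}
    (h₁ : IsStrongSolutionPair T k φ u₀₁ f₁ u₁ ξ₁) (h₂ : IsStrongSolutionPair T k φ u₀₂ f₂ u₂ ξ₂) :
    ‖u₁ - u₂‖ ^ 2 ≤ (16 / k T * (1 / k T + 1 / 2)) * ‖f₁ - f₂‖ ^ 2 +
      (16 / k T * (2 * (∫ s in Ioo 0 T, k s) + T / 2) + 2 * T) * ‖u₀₁ - u₀₂‖ ^ 2 := by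
  obtain ⟨g₁, hg₁, hu₁⟩ := h₁.exists_eq_convL2 hT hkl
  obtain ⟨g₂, hg₂, hu₂⟩ := h₂.exists_eq_convL2 hT hkl
  have hmono := h₁.inner_sub_nonneg hφ h₂
  set A := convL2 T H ((Ioo 0 T).indicator l) (hkl.right.isCausalKernel T).integrable
  have hk0 : 0 < k T := hkl.left_pos hT
  obtain ⟨hc1, hc2⟩ := convL2_coercive hT (hkl.left.isCausalKernel T)
    (hkl.right.isCausalKernel T) (fun t ht => hkl.convolution_eq_one ht) (κ := k T)
    (fun t ht => by
      rw [indicator_of_mem ht]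
      exact hkl.left.antitone (mem_Ioi.2 ht.1) (mem_Ioi.2 hT) ht.2.le) (g₁ - g₂)
  rw [integral_indicator measurableSet_Ioo] at hc2
  set K := ∫ s in Ioo 0 T, k s
  set a := u₀₁ - u₀₂ with ha
  set C : L2Space T H := Lp.const 2 (volume.restrict (Ioo 0 T)) a with hC
  have hCn : ‖C‖ ^ 2 = T * ‖a‖ ^ 2 := L2Space.norm_sq_const hT a
  set w := A (g₁ - g₂) with hw
  set g := g₁ - g₂ with hg
  set h := f₁ - f₂ with hh
  have hu : u₁ - u₂ = C + w := by
    rw [hu₁, hu₂, hC, ha, hw, hg, map_sub, map_sub]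
    abel
  have hζ : ξ₁ - ξ₂ = h - g := by
    rw [hh, hg, ← hg₁, ← hg₂]
    abel
  rw [hu, hζ] at hmono
  rw [hu]
  have hc3 : -(8 * inner ℝ g C) ≤ 2 * inner ℝ g w + K * (16 * ‖a‖ ^ 2) := by
    -- The factor `-4` fixes the sign and makes `-(g, C)` cost only `X / 4`.
    have := hc2 ((-4 : ℝ) • a)
    have e : Lp.const 2 (volume.restrict (Ioo 0 T)) ((-4 : ℝ) • a) = (-4 : ℝ) • C := rfl
    rw [e, real_inner_smul_right, norm_smul, mul_pow] at this
    norm_num at this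
    linarith
  rw [inner_sub_left, inner_add_right, inner_add_right] at hmono
  set X := inner ℝ g w
  have hhC : inner ℝ h C ≤ 1 / 2 * ‖h‖ ^ 2 + 1 / 2 * (T * ‖a‖ ^ 2) := by
    rw [← hCn]
    nlinarith [real_inner_le_norm h C, sq_nonneg (‖h‖ - ‖C‖)]
  have hhw : inner ℝ h w ≤ 1 / k T * ‖h‖ ^ 2 + X / 2 := by
    -- Young's inequality weighted so that coercivity turns `¼ k(T) ‖w‖²` into at most `X / 2`.
    have h1 : ‖h‖ * ‖w‖ ≤ 1 / k T * ‖h‖ ^ 2 + 1 / 4 * (k T * ‖w‖ ^ 2) := by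
      have h2 : 1 / k T * ‖h‖ ^ 2 + 1 / 4 * (k T * ‖w‖ ^ 2) - ‖h‖ * ‖w‖ =
          1 / k T * (‖h‖ - k T * ‖w‖ / 2) ^ 2 := by
        field_simp
        ring
      have h3 : 0 ≤ 1 / k T * (‖h‖ - k T * ‖w‖ / 2) ^ 2 := by positivity
      linarith
    linarith [real_inner_le_norm h w]
  have hX : X ≤ 4 * ((1 / k T + 1 / 2) * ‖h‖ ^ 2 + (2 * K + T / 2) * ‖a‖ ^ 2) := by
    linarith
  have hwX : ‖w‖ ^ 2 ≤ 2 / k T * X := by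
    rw [div_mul_eq_mul_div, le_div_iff₀ hk0]
    linarith
  have hwX' : ‖w‖ ^ 2 ≤ 2 / k T *
      (4 * ((1 / k T + 1 / 2) * ‖h‖ ^ 2 + (2 * K + T / 2) * ‖a‖ ^ 2)) :=
    hwX.trans (mul_le_mul_of_nonneg_left hX (by positivity))
  have hsum : ‖C + w‖ ^ 2 ≤ 2 * ‖C‖ ^ 2 + 2 * ‖w‖ ^ 2 := by
    nlinarith [norm_add_le C w, norm_nonneg (C + w), sq_nonneg (‖C‖ - ‖w‖)]
  rw [hCn] at hsum
  refine hsum.trans ((add_le_add_right (mul_le_mul_of_nonneg_left hwX' zero_le_two) _).trans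
    (le_of_eq ?_))
  ring

end Dependence

end

theorem mainTheorem3 (T : ℝ) (hT : 0 < T) (k l : ℝ → ℝ) (hkl : IsPCPair k l) :
    ∃ c : ℝ, 0 ≤ c ∧
      ∀ (H : Type*) [NormedAddCommGroup H] [InnerProductSpace ℝ H] [CompleteSpace H]
        (φ : ℝ → H → EReal), (∀ t ∈ Icc 0 T, IsProperLscConvex (φ t)) →
        ∀ (u₀₁ u₀₂ : H) (f₁ f₂ u₁ u₂ ξ₁ ξ₂ : L2Space T H),
          IsStrongSolutionPair T k φ u₀₁ f₁ u₁ ξ₁ →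
          IsStrongSolutionPair T k φ u₀₂ f₂ u₂ ξ₂ →
          ‖u₁ - u₂‖ ^ 2 ≤ c * (‖u₀₁ - u₀₂‖ ^ 2 + ‖f₁ - f₂‖ ^ 2) ∧
            (u₀₁ = u₀₂ → f₁ = f₂ → u₁ = u₂) := by
  have hk0 : 0 < k T := hkl.left_pos hT
  have hK : 0 ≤ ∫ s in Ioo 0 T, k s :=
    setIntegral_nonneg measurableSet_Ioo fun s hs => hkl.left.nonneg s hs.1
  set c₁ := 16 / k T * (1 / k T + 1 / 2) with hc₁
  set c₂ := 16 / k T * (2 * (∫ s in Ioo 0 T, k s) + T / 2) + 2 * T with hc₂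
  have h1 : 0 ≤ c₁ := by positivity
  have h2 : 0 ≤ c₂ := by positivity
  refine ⟨c₁ + c₂, add_nonneg h1 h2, ?_⟩
  intro H _ _ _ φ hφ u₀₁ u₀₂ f₁ f₂ u₁ u₂ ξ₁ ξ₂ s₁ s₂
  have hle : ‖u₁ - u₂‖ ^ 2 ≤ (c₁ + c₂) * (‖u₀₁ - u₀₂‖ ^ 2 + ‖f₁ - f₂‖ ^ 2) := by
    have := s₁.norm_sub_sq_le hT hkl hφ s₂
    rw [← hc₁, ← hc₂] at this
    have h3 := mul_nonneg h1 (sq_nonneg ‖u₀₁ - u₀₂‖)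
    have h4 := mul_nonneg h2 (sq_nonneg ‖f₁ - f₂‖)
    linarith
  refine ⟨hle, fun hu hf => ?_⟩
  subst hu hf
  simp only [sub_self, norm_zero] at hle
  have h0 : ‖u₁ - u₂‖ ^ 2 ≤ 0 := by simpa using hle
  exact sub_eq_zero.1 (norm_eq_zero.1 (pow_eq_zero_iff two_ne_zero |>.1
    (le_antisymm h0 (sq_nonneg _))))
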